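/- Let $D\subset\mathbb C^n$ be a pseudoconvex open set (not necessarily connected), that is, an open set on which $-\log\operatorname{dist}(\cdot,\mathbb C^n\setminus D)$ is plurisubharmonic (with $\mathbb C^n$ itself counted as pseudoconvex), and let $A\subset\partial D$ be relatively open in $\partial D$. Call $a\in\partial D$ a $\mathcal C^2$ smooth, strongly pseudoconvex point of $\partial D$ if there are an open neighbourhood $U$ of $a$ and a $\mathcal C^2$ function $\rho:U\to\mathbb R$ with $D\cap U=\{z\in U:\rho(z)<0\}$, $d\rho(a)\neq0$, and $$\sum_{j,k=1}^n\frac{\partial^2\rho}{\partial z_j\partial\bar z_k}(a)\,w_j\bar w_k>0\quad\text{for all } w\in\mathbb C^n\setminus\{0\}\text{ with }\sum_{j=1}^n\frac{\partial\rho}{\partial z_j}(a)\,w_j=0 .$$ Suppose that $A=\bigcup_{j\in J}A_j$ for some family $(A_j)_{j\in J}$ of sets such that (i) for every $j\in J$, $A_j$ is a connected (possibly empty), relatively open and bounded subset of $\partial D$; (ii) $\overline{A_j}\cap\overline{\bigcup_{k\in J\setminus\{j\}}A_k}=\varnothing$ for every $j\in J$; (iii) $\bigcup_{j\in J}\overline{A_j}$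 is contained in the set of $\mathcal C^2$ smooth, strongly pseudoconvex points of $\partial D$. Then the pair $(A,D)$ satisfies hypothesis $(\mathcal H)$: there is a sequence $(D_k)_{k=1}^\infty$ of pseudoconvex open sets in $\mathbb C^n$ such that $D_k\cap\overline D=D\cup A$ for every $k$, and $\bigcap_{k=1}^\infty D_k=D\cup A$. -/

import Mathlib

noncomputable section

namespace BoundaryCross

/-- `ℂⁿ` with its Euclidean norm. -/
abbrev Cn (n : ℕ) : Type := EuclideanSpace ℂ (Fin n)

/-- A real-valued function is plurisubharmonic on `D` if it is upper semicontinuous on `D` and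
satisfies the sub-mean value inequality on every closed complex disc contained in `D`.
(For a finite-valued plurisubharmonic function, integrability over circles is automatic; it is
listed because the Bochner integral of a non-integrable function is `0` by convention.) -/
def PlurisubharmonicOn {n : ℕ} (u : Cn n → ℝ) (D : Set (Cn n)) : Prop :=
  UpperSemicontinuousOn u D ∧
    ∀ z w : Cn n, (∀ ζ : ℂ, ‖ζ‖ ≤ 1 → z + ζ • w ∈ D) →
      CircleIntegrable (fun ζ : ℂ => u (z + ζ • w)) 0 1 ∧
        u z ≤ Real.circleAverage (fun ζ : ℂ => u (z + ζ • w)) 0 1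

/-- An open set `D` is pseudoconvex if `-log dist(·, ℂⁿ \ D)` is plurisubharmonic on `D`.
(For `D = ℂⁿ` the function below is the constant `0`, so that `ℂⁿ` is pseudoconvex,
in accordance with the usual convention.) -/
def IsPseudoconvex {n : ℕ} (D : Set (Cn n)) : Prop :=
  IsOpen D ∧ PlurisubharmonicOn (fun z => -Real.log (Metric.infDist z Dᶜ)) D

/-- The Levi form `∑ j k, ∂²ρ/∂z_j∂z̄_k (a) w_j w̄_k` of a `C²` function, written through the real
Hessian: it equals `(D²ρ(a)(w, w) + D²ρ(a)(iw, iw)) / 4`. -/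
def leviForm {n : ℕ} (ρ : Cn n → ℝ) (a w : Cn n) : ℝ :=
  (fderiv ℝ (fderiv ℝ ρ) a w w +
    fderiv ℝ (fderiv ℝ ρ) a (Complex.I • w) (Complex.I • w)) / 4

/-- The set of `C²` smooth, strongly pseudoconvex boundary points of `D`: near such a point `a`
the set `D` is `{ρ < 0}` for a `C²` function `ρ` with `dρ(a) ≠ 0` whose Levi form at `a` is
positive definite on the complex tangent space `{w | ∂ρ(a) w = 0}`, that is,
on `{w | dρ(a) w = 0 and dρ(a) (iw) = 0}`. -/
def stronglyPseudoconvexPoints {n : ℕ} (D : Set (Cn n)) : Set (Cn n) :=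
  {a | a ∈ frontier D ∧ ∃ (U : Set (Cn n)) (ρ : Cn n → ℝ),
    IsOpen U ∧ a ∈ U ∧ ContDiffOn ℝ 2 ρ U ∧ D ∩ U = {z ∈ U | ρ z < 0} ∧
    fderiv ℝ ρ a ≠ 0 ∧
    ∀ w : Cn n, w ≠ 0 → fderiv ℝ ρ a w = 0 → fderiv ℝ ρ a (Complex.I • w) = 0 →
      0 < leviForm ρ a w}

/-- `A` is a relatively open subset of `S`. -/
def IsRelOpenIn {X : Type*} [TopologicalSpace X] (A S : Set X) : Prop :=
  ∃ O : Set X, IsOpen O ∧ A = S ∩ O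

/-- Hypothesis (H) for a pair `(A, D)` of an open set `D` and a relatively open subset `A` of
the boundary of `D`. -/
def HypothesisH {n : ℕ} (A D : Set (Cn n)) : Prop :=
  ∃ Dk : ℕ → Set (Cn n),
    (∀ k, IsPseudoconvex (Dk k)) ∧
    (∀ k, Dk k ∩ closure D = D ∪ A) ∧
    ⋂ k, Dk k = D ∪ A

end BoundaryCross

end

namespace BoundaryCross

open Filter Topology Metric Set

/-! Near the compact closure of a single `Aj j`, the set `D` has a `C²` defining function `ρ` with
uniformly positive Levi form. Take `χ ≥ 0` of class `C²` whose nonvanishing set is a small open set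
meeting the boundary of `D` exactly in `Aj j`. For small `ε` the function `ρ - ε χ` still has
nonnegative Levi form near the closure of `Aj j`, so passing from `ρ < 0` to `ρ - ε χ < 0` pushes
the boundary outwards precisely along `Aj j` (`exists_bump`). Separation makes the bumps disjoint,
and shrinking them uniformly as `k → ∞` forces the intersection down to `D ∪ A`.

The substance is that `D` with infinitely many bumps is pseudoconvex. The definition by `-log dist`
is neither visibly local nor visibly stable under increasing unions, so everything passes through
the continuity principle for analytic discs. It implies pseudoconvexity
(`ContinuityPrinciple.isPseudoconvex`), survives directed unions by compactness
(`ContinuityPrinciple.iUnion_of_directed`), and follows from local pseudoconvexity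
(`continuityPrinciple_of_locally_isPseudoconvex`). Finitely many bumps are handled by the local
criterion, arbitrarily many by a directed union.

Discs are controlled by a maximum principle along holomorphic curves (`HasMaxPrincipleOn`), which
holds both for `C²` functions with nonnegative Levi form and for continuous functions with the
sub-mean value property on affine discs. -/

/-! ### The maximum principle along holomorphic curves -/

/-- A compactness penalty argument: a suitable `N` exists near each point, and enlarging `N` does no
harm because `g ≥ 0`. It supplies the penalty in `SubmeanOn.hasMaxPrincipleOn` and the constant in
`exists_leviForm_pos`. -/
theorem exists_forall_sub_mul_neg {X : Type*} [TopologicalSpace X] {C : Set X} (hC : IsCompact C)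
    {f g : X → ℝ} (hf : ContinuousOn f C) (hg : ContinuousOn g C) (hg0 : ∀ x ∈ C, 0 ≤ g x)
    (h : ∀ x ∈ C, g x = 0 → f x < 0) : ∃ N : ℝ, 0 ≤ N ∧ ∀ x ∈ C, f x - N * g x < 0 := by
  suffices H : ∃ N : ℝ, 0 ≤ N ∧ ∀ x ∈ C, x ∈ C → f x - N * g x < 0 by
    obtain ⟨N, h0, h1⟩ := H
    exact ⟨N, h0, fun x hx => h1 x hx hx⟩
  refine hC.induction_on (p := fun s => ∃ N : ℝ, 0 ≤ N ∧ ∀ x ∈ s, x ∈ C → f x - N * g x < 0)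
    ⟨0, le_rfl, by simp⟩ ?_ ?_ ?_
  · rintro s t hst ⟨N, h0, h1⟩
    exact ⟨N, h0, fun x hx => h1 x (hst hx)⟩
  · rintro s t ⟨N, h0, h1⟩ ⟨M, h0', h1'⟩
    refine ⟨max N M, le_max_of_le_left h0, ?_⟩
    rintro x (hx | hx) hxC
    · have := h1 x hx hxC
      nlinarith [mul_le_mul_of_nonneg_right (le_max_left N M) (hg0 x hxC)]
    · have := h1' x hx hxC
      nlinarith [mul_le_mul_of_nonneg_right (le_max_right N M) (hg0 x hxC)]
  · intro x hx
    obtain ⟨N, h0, h1⟩ : ∃ N : ℝ, 0 ≤ N ∧ f x - N * g x < 0 := by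
      rcases (hg0 x hx).eq_or_lt with h' | h'
      · exact ⟨0, le_rfl, by simpa using h x hx h'.symm⟩
      · refine ⟨(|f x| + 1) / g x, by positivity, ?_⟩
        rw [div_mul_cancel₀ _ h'.ne']
        linarith [le_abs_self (f x)]
    have hc : ContinuousWithinAt (fun y => f y - N * g y) C x :=
      (hf x hx).sub (continuousWithinAt_const.mul (hg x hx))
    have he := hc.tendsto.eventually (gt_mem_nhds h1)
    exact ⟨_, he, N, h0, fun y hy _ => hy⟩

theorem circleAverage_re_of_differentiable {f : ℂ → ℂ} (hf : Differentiable ℂ f) (c : ℂ) (R : ℝ) :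
    Real.circleAverage (fun s => (f s).re) c R = (f c).re := by
  have h1 : CircleIntegrable f c R := hf.continuous.continuousOn.circleIntegrable'
  have h2 := Complex.reCLM.circleAverage_comp_comm h1
  rw [hf.diffContOnCl.circleAverage] at h2
  exact h2

/-- `u` satisfies the maximum principle along holomorphic curves meeting `W`. -/
def HasMaxPrincipleOn {n : ℕ} (u : Cn n → ℝ) (W : Set (Cn n)) : Prop :=
  ∀ φ : ℂ → Cn n, Differentiable ℂ φ → ∀ τ, φ τ ∈ W → ∀ ε > 0,
    ¬ IsLocalMax (fun s => u (φ s) + ε * ‖s‖ ^ 2) τ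

/-- The sub-mean value inequality on closed complex discs contained in `W`. -/
def SubmeanOn {n : ℕ} (u : Cn n → ℝ) (W : Set (Cn n)) : Prop :=
  ∀ z w : Cn n, (∀ ζ : ℂ, ‖ζ‖ ≤ 1 → z + ζ • w ∈ W) →
    CircleIntegrable (fun ζ : ℂ => u (z + ζ • w)) 0 1 ∧
      u z ≤ Real.circleAverage (fun ζ : ℂ => u (z + ζ • w)) 0 1

/-- Move along `s ↦ (z + s v, τ + s)` with `v = φ'(τ)`. To first order the difference `z - φ τ` does
not change, so up to a harmonic term the penalty costs only a small multiple of `‖s‖²`, which the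
gain `ε/2 ‖s‖²` outweighs. Averaging over a small circle then contradicts the sub-mean value
inequality on an affine disc. -/
theorem SubmeanOn.not_isLocalMax_penalized {n : ℕ} {u : Cn n → ℝ} {W : Set (Cn n)}
    (hW : IsOpen W) (hu : SubmeanOn u W) {φ : ℂ → Cn n} (hφ : Differentiable ℂ φ)
    {z : Cn n} (hz : z ∈ W) (τ τ₀ : ℂ) {ε N : ℝ} (hε : 0 < ε) (hN : 0 ≤ N) :
    ¬ IsLocalMax (fun p : Cn n × ℂ =>
      u p.1 + (ε * ‖p.2‖ ^ 2 - ε / 2 * ‖p.2 - τ₀‖ ^ 2) - N * ‖p.1 - φ p.2‖ ^ 2) (z, τ) := by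
  intro hmax
  set v := deriv φ τ with hv
  -- Chosen so that the penalty error `N η² r²` uses up at most half of the gain `ε/2 r²`.
  set η := Real.sqrt (ε / (4 * (N + 1))) with hη
  have hηpos : 0 < η := Real.sqrt_pos.2 (by positivity)
  have hη2 : N * η ^ 2 ≤ ε / 4 := by
    rw [hη, Real.sq_sqrt (by positivity), ← sub_nonneg]
    have : ε / 4 - N * (ε / (4 * (N + 1))) = ε / (4 * (N + 1)) := by field_simp; ring
    rw [this]; positivity
  have e1 : ∀ᶠ s : ℂ in 𝓝 0, ‖φ (τ + s) - φ τ - s • v‖ ≤ η * ‖s‖ := by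
    have := (hasDerivAt_iff_isLittleO_nhds_zero.1 (hφ τ).hasDerivAt).def hηpos
    simpa using this
  have hline : Continuous fun s : ℂ => z + s • v := by fun_prop
  have e2 : ∀ᶠ s : ℂ in 𝓝 0, z + s • v ∈ W := by
    refine hline.continuousAt.eventually_mem (hW.mem_nhds ?_)
    simpa using hz
  have e3 : ∀ᶠ s : ℂ in 𝓝 0, u (z + s • v) + (ε * ‖τ + s‖ ^ 2 - ε / 2 * ‖τ + s - τ₀‖ ^ 2)
      - N * ‖z + s • v - φ (τ + s)‖ ^ 2 ≤
      u z + (ε * ‖τ‖ ^ 2 - ε / 2 * ‖τ - τ₀‖ ^ 2) - N * ‖z - φ τ‖ ^ 2 := by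
    have hc : Continuous fun s : ℂ => ((z + s • v, τ + s) : Cn n × ℂ) := by fun_prop
    have ht : Tendsto (fun s : ℂ => ((z + s • v, τ + s) : Cn n × ℂ)) (𝓝 0) (𝓝 (z, τ)) := by
      have := hc.tendsto 0
      simpa using this
    exact ht.eventually hmax
  obtain ⟨R, hR, hball⟩ := Metric.eventually_nhds_iff_ball.1 (e1.and (e2.and e3))
  set r := R / 2 with hr
  have hrpos : 0 < r := by positivity
  have hmem : ∀ ζ : ℂ, ‖ζ‖ ≤ 1 → (r : ℂ) * ζ ∈ ball (0 : ℂ) R := by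
    intro ζ hζ
    rw [mem_ball_zero_iff, norm_mul, Complex.norm_real, Real.norm_of_nonneg hrpos.le]
    nlinarith
  set g₀ := z - φ τ with hg₀
  -- The real part of `Ψ` collects all the harmonic terms of the expansion; `Ψ 0 = 0`, so they
  -- average to zero.
  set Ψ : ℂ → ℂ := fun s => 2 * ε * (starRingEnd ℂ τ * s) - ε * (starRingEnd ℂ (τ - τ₀) * s)
    - 2 * N * inner ℂ g₀ (s • v - (φ (τ + s) - φ τ)) with hΨ
  have hΨd : Differentiable ℂ Ψ := by
    have h1 : Differentiable ℂ fun s : ℂ => s • v - (φ (τ + s) - φ τ) := by fun_prop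
    have h2 : Differentiable ℂ fun s : ℂ => inner ℂ g₀ (s • v - (φ (τ + s) - φ τ)) :=
      (innerSL ℂ g₀).differentiable.comp h1
    fun_prop
  have key : ∀ ζ : ℂ, ‖ζ‖ = 1 →
      u (z + ζ • ((r : ℂ) • v)) ≤ u z - (Ψ (r * ζ)).re - ε / 4 * r ^ 2 := by
    intro ζ hζ
    obtain ⟨h1, h2, h3⟩ := hball _ (hmem ζ hζ.le)
    set s : ℂ := r * ζ with hs
    have hsn : ‖s‖ = r := by
      rw [hs, norm_mul, Complex.norm_real, Real.norm_of_nonneg hrpos.le, hζ, mul_one]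
    have hzs : z + ζ • ((r : ℂ) • v) = z + s • v := by rw [smul_smul, mul_comm]
    rw [hzs]
    have hn : ‖z + s • v - φ (τ + s)‖ ^ 2 = ‖g₀‖ ^ 2 +
        2 * (inner ℂ g₀ (s • v - (φ (τ + s) - φ τ))).re + ‖s • v - (φ (τ + s) - φ τ)‖ ^ 2 := by
      have : z + s • v - φ (τ + s) = g₀ + (s • v - (φ (τ + s) - φ τ)) := by rw [hg₀]; abel
      rw [this, norm_add_sq (𝕜 := ℂ)]; rfl
    have hq1 : ‖τ + s‖ ^ 2 = ‖τ‖ ^ 2 + 2 * (starRingEnd ℂ τ * s).re + r ^ 2 := by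
      rw [← hsn, Complex.sq_norm, Complex.sq_norm, Complex.sq_norm]
      simp [Complex.normSq_apply]; ring
    have hq2 : ‖τ + s - τ₀‖ ^ 2 =
        ‖τ - τ₀‖ ^ 2 + 2 * (starRingEnd ℂ (τ - τ₀) * s).re + r ^ 2 := by
      rw [← hsn, Complex.sq_norm, Complex.sq_norm, Complex.sq_norm]
      simp [Complex.normSq_apply]; ring
    have hΨs : (Ψ s).re = 2 * ε * (starRingEnd ℂ τ * s).re
        - ε * (starRingEnd ℂ (τ - τ₀) * s).re
        - 2 * N * (inner ℂ g₀ (s • v - (φ (τ + s) - φ τ))).re := by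
      simp only [hΨ, Complex.sub_re]
      congr 1
      · congr 1
        · rw [show (2 * (ε : ℂ)) = ((2 * ε : ℝ) : ℂ) by push_cast; rfl, Complex.re_ofReal_mul]
        · rw [Complex.re_ofReal_mul]
      · rw [show (2 * (N : ℂ)) = ((2 * N : ℝ) : ℂ) by push_cast; rfl, Complex.re_ofReal_mul]
    have hsmall : ‖s • v - (φ (τ + s) - φ τ)‖ ^ 2 ≤ η ^ 2 * r ^ 2 := by
      rw [← mul_pow, norm_sub_rev, ← hsn]
      exact pow_le_pow_left₀ (norm_nonneg _) h1 2
    have hNs := mul_le_mul_of_nonneg_left hsmall hN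
    have hNη : N * (η ^ 2 * r ^ 2) ≤ ε / 4 * r ^ 2 := by
      rw [← mul_assoc]; exact mul_le_mul_of_nonneg_right hη2 (by positivity)
    rw [hn, hq1, hq2] at h3
    rw [hΨs]
    linarith
  obtain ⟨hint, hmean⟩ := hu z ((r : ℂ) • v) (fun ζ hζ => by
    have := (hball _ (hmem ζ hζ)).2.1
    rwa [mul_comm, ← smul_smul] at this)
  set Φ : ℂ → ℂ := fun ζ => (u z : ℂ) - Ψ (r * ζ) - ((ε / 4 * r ^ 2 : ℝ) : ℂ) with hΦ
  have hΦd : Differentiable ℂ Φ := by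
    have : Differentiable ℂ fun ζ : ℂ => Ψ (r * ζ) := hΨd.comp (by fun_prop)
    fun_prop
  have hΦre : ∀ ζ, (Φ ζ).re = u z - (Ψ (r * ζ)).re - ε / 4 * r ^ 2 := by
    intro ζ; simp only [hΦ, Complex.sub_re, Complex.ofReal_re]
  have hle : Real.circleAverage (fun ζ : ℂ => u (z + ζ • ((r : ℂ) • v))) 0 1 ≤
      Real.circleAverage (fun ζ => (Φ ζ).re) 0 1 := by
    refine Real.circleAverage_mono hint ?_ ?_
    · exact (Complex.continuous_re.comp hΦd.continuous).continuousOn.circleIntegrable'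
    · intro ζ hζ
      rw [hΦre]
      exact key ζ (by simpa using hζ)
  rw [circleAverage_re_of_differentiable hΦd, hΦre] at hle
  have hΨ0 : Ψ (r * 0) = 0 := by simp [hΨ]
  rw [hΨ0] at hle
  have : 0 < ε / 4 * r ^ 2 := by positivity
  simp only [Complex.zero_re] at hle
  linarith

/-- The hypothesis concerns affine discs only, whereas `φ` is arbitrary. Doubling the variables
avoids composing with `φ`: treat `(z, τ)` as independent and penalize `‖z - φ τ‖²`. The term `-ε/2
‖τ - τ₀‖²` makes the maximum strict, so for large `N` the penalized maximum lies in the interior. -/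
theorem SubmeanOn.hasMaxPrincipleOn {n : ℕ} {u : Cn n → ℝ} {W : Set (Cn n)}
    (hW : IsOpen W) (huc : ContinuousOn u W) (hu : SubmeanOn u W) : HasMaxPrincipleOn u W := by
  intro φ hφ τ₀ hτ ε hε hmax
  obtain ⟨R, hR, hRW⟩ := Metric.nhds_basis_closedBall.mem_iff.1 (hW.mem_nhds hτ)
  obtain ⟨R', hR', hmax'⟩ := Metric.nhds_basis_closedBall.mem_iff.1 hmax
  set P : Set (Cn n × ℂ) := closedBall (φ τ₀) R ×ˢ closedBall τ₀ R' with hP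
  have hPc : IsCompact P := (isCompact_closedBall _ _).prod (isCompact_closedBall _ _)
  set Q : Set (Cn n × ℂ) := ball (φ τ₀) R ×ˢ ball τ₀ R' with hQ
  have hQo : IsOpen Q := isOpen_ball.prod isOpen_ball
  have huP : ContinuousOn (fun p : Cn n × ℂ => u p.1) P :=
    huc.comp continuousOn_fst (fun p hp => hRW hp.1)
  set M := u (φ τ₀) + ε * ‖τ₀‖ ^ 2 with hM
  set f : Cn n × ℂ → ℝ := fun p => u p.1 + (ε * ‖p.2‖ ^ 2 - ε / 2 * ‖p.2 - τ₀‖ ^ 2) with hf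
  set g : Cn n × ℂ → ℝ := fun p => ‖p.1 - φ p.2‖ ^ 2 with hg
  have hφc := hφ.continuous
  have hfc : ContinuousOn f P := huP.add (by fun_prop)
  have hgc : Continuous g := by fun_prop
  obtain ⟨N, hN, hneg⟩ := exists_forall_sub_mul_neg (C := P \ Q) (hPc.diff hQo)
    (f := fun p => f p - M) (g := g) ((hfc.mono sdiff_subset).sub continuousOn_const)
    hgc.continuousOn (fun p _ => by positivity) (by
      rintro ⟨z, τ⟩ ⟨⟨hz, hτP⟩, hnQ⟩ h0
      have hzφ : z = φ τ := by
        have : ‖z - φ τ‖ = 0 := by simpa [hg] using h0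
        exact sub_eq_zero.1 (norm_eq_zero.1 this)
      have h1 := hmax' hτP
      simp only [mem_ofPred_eq] at h1
      have hne : τ ≠ τ₀ := by
        rintro rfl
        apply hnQ
        subst hzφ
        exact ⟨mem_ball_self hR, mem_ball_self hR'⟩
      have h2 : 0 < ‖τ - τ₀‖ ^ 2 := by
        have := norm_pos_iff.2 (sub_ne_zero.2 hne)
        positivity
      simp only [hf, hM, hzφ]
      nlinarith)
  have hmem₀ : (φ τ₀, τ₀) ∈ P := ⟨mem_closedBall_self hR.le, mem_closedBall_self hR'.le⟩
  obtain ⟨p, hp, hpmax⟩ := hPc.exists_isMaxOn ⟨_, hmem₀⟩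
    (hfc.sub (continuousOn_const.mul hgc.continuousOn) : ContinuousOn (fun p => f p - N * g p) P)
  have hval : M ≤ f p - N * g p := by
    have := hpmax hmem₀
    simpa [hf, hg, hM] using this
  have hpQ : p ∈ Q := by
    by_contra h
    have := hneg p ⟨hp, h⟩
    linarith
  have hloc : IsLocalMax (fun p => f p - N * g p) p := by
    refine hpmax.isLocalMax (mem_of_superset (hQo.mem_nhds hpQ) ?_)
    exact prod_mono ball_subset_closedBall ball_subset_closedBall
  exact hu.not_isLocalMax_penalized hW hφ (z := p.1) (hRW hp.1) p.2 τ₀ hε hN hloc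

/-- If `c` were positive, the point would be both a local minimum and a local maximum, so `h` would
be locally constant and `c = 0`. -/
theorem nonpos_of_isLocalMax_of_hasDerivAt {h h' : ℝ → ℝ} {c : ℝ} (hh : ∀ t, HasDerivAt h (h' t) t)
    (hh' : HasDerivAt h' c 0) (hmax : IsLocalMax h 0) : c ≤ 0 := by
  by_contra! hc
  have hd : deriv h = h' := funext fun t => (hh t).deriv
  have hdd : deriv (deriv h) 0 = c := by rw [hd]; exact hh'.deriv
  have hmin : IsLocalMin h 0 := isLocalMin_of_deriv_deriv_pos (by rw [hdd]; exact hc)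
    hmax.deriv_eq_zero (hh 0).continuousAt
  have hconst : h =ᶠ[𝓝 0] fun _ => h 0 := by
    filter_upwards [hmax, hmin] with t h1 h2 using le_antisymm h1 h2
  have : deriv (deriv h) 0 = 0 := by
    rw [hconst.deriv.deriv_eq]
    simp
  linarith

theorem second_order_nonpos_of_isLocalMax {E : Type*} [NormedAddCommGroup E] [NormedSpace ℝ E]
    {ρ : E → ℝ} (hρ : ContDiff ℝ 2 ρ) {γ γ' : ℝ → E} {γ'' : E}
    (hγ : ∀ t, HasDerivAt γ (γ' t) t) (hγ' : HasDerivAt γ' γ'' 0) (a b ε : ℝ)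
    (hmax : IsLocalMax (fun t => ρ (γ t) + (a + b * t + ε * t ^ 2)) 0) :
    fderiv ℝ (fderiv ℝ ρ) (γ 0) (γ' 0) (γ' 0) + fderiv ℝ ρ (γ 0) γ'' + 2 * ε ≤ 0 := by
  have hρd : Differentiable ℝ ρ := hρ.differentiable (by norm_num)
  have hρd' : Differentiable ℝ (fderiv ℝ ρ) :=
    (hρ.fderiv_right (m := 1) (by norm_num)).differentiable (by norm_num)
  have hq : ∀ t : ℝ, HasDerivAt (fun t : ℝ => a + b * t + ε * t ^ 2) (b + ε * (2 * t)) t := by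
    intro t
    have h1 := ((hasDerivAt_id t).const_mul b).const_add a
    have h2 := (hasDerivAt_pow 2 t).const_mul ε
    exact (h1.add h2).congr_deriv (by simp)
  have h1 : ∀ t : ℝ, HasDerivAt (fun t => ρ (γ t) + (a + b * t + ε * t ^ 2))
      (fderiv ℝ ρ (γ t) (γ' t) + (b + ε * (2 * t))) t :=
    fun t => ((hρd _).hasFDerivAt.comp_hasDerivAt t (hγ t)).add (hq t)
  have h2 := ((hρd' (γ 0)).hasFDerivAt.comp_hasDerivAt (0 : ℝ) (hγ 0)).clm_apply hγ'
  have h3 : HasDerivAt (fun t : ℝ => b + ε * (2 * t)) (ε * 2) 0 := by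
    have := (((hasDerivAt_id (0 : ℝ)).const_mul 2).const_mul ε).const_add b
    simpa using this
  have := nonpos_of_isLocalMax_of_hasDerivAt h1 (h2.add h3) hmax
  rw [mul_comm ε 2] at this
  exact this

theorem second_order_nonpos_of_isLocalMax_comp {E : Type*} [NormedAddCommGroup E] [NormedSpace ℂ E]
    [NormedSpace ℝ E] [IsScalarTower ℝ ℂ E] [CompleteSpace E]
    {ρ : E → ℝ} (hρ : ContDiff ℝ 2 ρ) {φ : ℂ → E} (hφ : Differentiable ℂ φ) {τ : ℂ} {ε : ℝ}
    (hmax : IsLocalMax (fun s => ρ (φ s) + ε * ‖s‖ ^ 2) τ) {d : ℂ} (hd : ‖d‖ = 1) :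
    fderiv ℝ (fderiv ℝ ρ) (φ τ) (d • deriv φ τ) (d • deriv φ τ)
        + fderiv ℝ ρ (φ τ) ((d * d) • deriv (deriv φ) τ) + 2 * ε ≤ 0 := by
  have hφ' : Differentiable ℂ (deriv φ) := by
    have : ContDiff ℂ 2 φ := hφ.contDiff
    exact (this.iterate_deriv' 1 1).differentiable (by norm_num)
  have hl : ∀ t : ℝ, HasDerivAt (fun t : ℝ => τ + t * d) d t := by
    intro t
    simpa using (((hasDerivAt_id t).ofReal_comp).mul_const d).const_add τ
  have hγ : ∀ t : ℝ, HasDerivAt (fun t : ℝ => φ (τ + t * d)) (d • deriv φ (τ + t * d)) t :=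
    fun t => (hφ _).hasDerivAt.scomp t (hl t)
  have hγ' : HasDerivAt (fun t : ℝ => d • deriv φ (τ + t * d))
      (d • d • deriv (deriv φ) (τ + (0 : ℝ) * d)) 0 :=
    ((hφ' _).hasDerivAt.scomp (0 : ℝ) (hl 0)).const_smul d
  have hm : IsLocalMax (fun t : ℝ => ρ (φ (τ + t * d)) +
      (ε * ‖τ‖ ^ 2 + ε * (2 * (starRingEnd ℂ τ * d).re) * t + ε * t ^ 2)) 0 := by
    have ht : Tendsto (fun t : ℝ => τ + t * d) (𝓝 0) (𝓝 τ) := by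
      have := (hl 0).continuousAt.tendsto
      simpa using this
    have hq : ∀ t : ℝ, ε * ‖τ + t * d‖ ^ 2 =
        ε * ‖τ‖ ^ 2 + ε * (2 * (starRingEnd ℂ τ * d).re) * t + ε * t ^ 2 := by
      intro t
      have hd2 : Complex.normSq d = 1 := by rw [← Complex.sq_norm, hd, one_pow]
      rw [Complex.normSq_apply] at hd2
      rw [Complex.sq_norm, Complex.sq_norm]
      simp only [Complex.normSq_apply, Complex.add_re, Complex.add_im, Complex.mul_re,
        Complex.mul_im, Complex.ofReal_re, Complex.ofReal_im, Complex.conj_re, Complex.conj_im]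
      linear_combination (ε * t ^ 2) * hd2
    have := ht.eventually hmax
    simp only [← hq]
    simpa [IsLocalMax, IsMaxFilter] using this
  have := second_order_nonpos_of_isLocalMax hρ hγ hγ' _ _ _ hm
  simpa [smul_smul] using this

/-- Add the second-order conditions in the directions `1` and `I`: the terms in `φ''` carry the
factors `1` and `-1` and cancel, leaving four times the Levi form plus `4ε`. -/
theorem hasMaxPrincipleOn_of_leviForm_nonneg {n : ℕ} {ρ : Cn n → ℝ} {W : Set (Cn n)}
    (hρ : ContDiff ℝ 2 ρ) (hL : ∀ z ∈ W, ∀ w, 0 ≤ leviForm ρ z w) : HasMaxPrincipleOn ρ W := by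
  intro φ hφ τ hτ ε hε hmax
  have h1 := second_order_nonpos_of_isLocalMax_comp hρ hφ hmax (d := 1) (by simp)
  have h2 := second_order_nonpos_of_isLocalMax_comp hρ hφ hmax (d := Complex.I) (by simp)
  have h3 := hL _ hτ (deriv φ τ)
  simp only [leviForm, one_smul, mul_one, Complex.I_mul_I, neg_smul, map_neg] at h1 h2 h3
  linarith

theorem HasMaxPrincipleOn.max {n : ℕ} {u v : Cn n → ℝ} {W : Set (Cn n)}
    (hu : HasMaxPrincipleOn u W) (hv : HasMaxPrincipleOn v W) :
    HasMaxPrincipleOn (fun z => max (u z) (v z)) W := by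
  intro φ hφ τ hτ ε hε hmax
  rcases le_total (v (φ τ)) (u (φ τ)) with h | h
  · refine hu φ hφ τ hτ ε hε ?_
    filter_upwards [hmax] with s hs
    rw [max_eq_left h] at hs
    linarith [le_max_left (u (φ s)) (v (φ s))]
  · refine hv φ hφ τ hτ ε hε ?_
    filter_upwards [hmax] with s hs
    rw [max_eq_right h] at hs
    linarith [le_max_right (u (φ s)) (v (φ s))]

theorem submeanOn_norm_sub_sq_sub {n : ℕ} (b : Cn n) (c : ℝ) :
    SubmeanOn (fun z => ‖z - b‖ ^ 2 - c) univ := by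
  intro z w _
  have hc : Continuous fun ζ : ℂ => ‖z + ζ • w - b‖ ^ 2 - c := by fun_prop
  have hint : CircleIntegrable (fun ζ : ℂ => ‖z + ζ • w - b‖ ^ 2 - c) 0 1 :=
    hc.continuousOn.circleIntegrable'
  refine ⟨hint, ?_⟩
  set Φ : ℂ → ℂ := fun ζ => ((‖z - b‖ ^ 2 - c : ℝ) : ℂ) + 2 * inner ℂ (z - b) (ζ • w) with hΦ
  have hΦd : Differentiable ℂ Φ := by
    have h1 : Differentiable ℂ fun ζ : ℂ => inner ℂ (z - b) (ζ • w) :=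
      (innerSL ℂ (z - b)).differentiable.comp (by fun_prop)
    fun_prop
  have h0 := circleAverage_re_of_differentiable hΦd 0 1
  have hΦ0 : (Φ 0).re = ‖z - b‖ ^ 2 - c := by
    simp only [hΦ, zero_smul, inner_zero_right, mul_zero, add_zero, Complex.ofReal_re]
  have hle : Real.circleAverage (fun ζ => (Φ ζ).re) 0 1 ≤
      Real.circleAverage (fun ζ : ℂ => ‖z + ζ • w - b‖ ^ 2 - c) 0 1 := by
    refine Real.circleAverage_mono
      (Complex.continuous_re.comp hΦd.continuous).continuousOn.circleIntegrable' hint ?_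
    intro ζ _
    have h1 : z + ζ • w - b = (z - b) + ζ • w := by abel
    have h2 : (Φ ζ).re = ‖z - b‖ ^ 2 - c + 2 * (inner ℂ (z - b) (ζ • w)).re := by
      simp only [hΦ, Complex.add_re, Complex.ofReal_re]
      rw [show (2 : ℂ) = ((2 : ℝ) : ℂ) by norm_num, Complex.re_ofReal_mul]
    have h3 : ‖(z - b) + ζ • w‖ ^ 2 = ‖z - b‖ ^ 2 + 2 * (inner ℂ (z - b) (ζ • w)).re
        + ‖ζ • w‖ ^ 2 := norm_add_sq (𝕜 := ℂ) _ _
    rw [h1, h2, h3]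
    nlinarith [sq_nonneg ‖ζ • w‖]
  rw [h0, hΦ0] at hle
  exact hle

/-- Maximize `u ∘ φ + ε ‖·‖²` on the closed disc. A maximum point with `u ∘ φ > c` would be interior
and mapped into `W`, which is excluded; then let `ε → 0`. Membership in `W` is needed only where `u`
exceeds `c`. -/
theorem HasMaxPrincipleOn.le_of_le_on_circle {n : ℕ} {u : Cn n → ℝ} {W : Set (Cn n)}
    (hu : HasMaxPrincipleOn u W) {φ : ℂ → Cn n} (hφ : Differentiable ℂ φ)
    (hc : ContinuousOn (fun τ => u (φ τ)) (closedBall 0 1)) {c : ℝ}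
    (hbd : ∀ τ, ‖τ‖ = 1 → u (φ τ) ≤ c) (hint : ∀ τ, ‖τ‖ ≤ 1 → c < u (φ τ) → φ τ ∈ W) :
    ∀ τ, ‖τ‖ ≤ 1 → u (φ τ) ≤ c := by
  intro τ hτ
  refine le_of_forall_pos_le_add fun ε hε => ?_
  obtain ⟨σ, hσ, hmax⟩ := (isCompact_closedBall (0 : ℂ) 1).exists_isMaxOn ⟨0, by simp⟩
    (hc.add (f := fun τ => u (φ τ)) (g := fun s : ℂ => ε * ‖s‖ ^ 2) (by fun_prop))
  have hσ1 : ‖σ‖ ≤ 1 := by simpa using hσ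
  have hle : u (φ τ) + ε * ‖τ‖ ^ 2 ≤ u (φ σ) + ε * ‖σ‖ ^ 2 := hmax (by simpa using hτ)
  have hcσ : u (φ σ) ≤ c := by
    by_contra! hlt
    have hσne : ‖σ‖ ≠ 1 := fun h => (hbd σ h).not_gt hlt
    refine hu φ hφ σ (hint σ hσ1 hlt) ε hε (hmax.isLocalMax ?_)
    exact closedBall_mem_nhds_of_mem (by simpa using lt_of_le_of_ne hσ1 hσne)
  nlinarith [sq_nonneg ‖τ‖, pow_le_one₀ (n := 2) (norm_nonneg σ) hσ1]

/-! ### The continuity principle and sublevel sets -/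

/-- The continuity principle (Kontinuitätssatz) for continuous families of analytic discs. -/
def ContinuityPrinciple {n : ℕ} (D : Set (Cn n)) : Prop :=
  ∀ φ : ℝ → ℂ → Cn n, Continuous (fun p : ℝ × ℂ => φ p.1 p.2) → (∀ t, Differentiable ℂ (φ t)) →
    (∀ τ, ‖τ‖ ≤ 1 → φ 0 τ ∈ D) → (∀ t ∈ Icc (0 : ℝ) 1, ∀ τ, ‖τ‖ = 1 → φ t τ ∈ D) →
    ∀ t ∈ Icc (0 : ℝ) 1, ∀ τ, ‖τ‖ ≤ 1 → φ t τ ∈ D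

/-- A connectedness argument in `t`: the parameters whose disc lies in `D` form an open set, those
whose disc lies in `F` form a closed one, and on `[0, 1]` the two coincide. -/
theorem forall_disc_mem_of_isClosed {X : Type*} [TopologicalSpace X] {D F : Set X} (hD : IsOpen D)
    (hF : IsClosed F) (hFD : F ⊆ D) {φ : ℝ → ℂ → X} (hφ : Continuous fun p : ℝ × ℂ => φ p.1 p.2)
    (h0 : ∀ τ, ‖τ‖ ≤ 1 → φ 0 τ ∈ D)
    (h : ∀ t ∈ Icc (0 : ℝ) 1, (∀ τ, ‖τ‖ ≤ 1 → φ t τ ∈ D) → ∀ τ, ‖τ‖ ≤ 1 → φ t τ ∈ F) :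
    ∀ t ∈ Icc (0 : ℝ) 1, ∀ τ, ‖τ‖ ≤ 1 → φ t τ ∈ D := by
  by_contra! hcon
  obtain ⟨t₁, ht₁, τ₁, hτ₁, hn⟩ := hcon
  have hU : IsOpen {t : ℝ | ∀ τ ∈ closedBall (0 : ℂ) 1, φ t τ ∈ D} := by
    rw [isOpen_iff_mem_nhds]
    intro t ht
    refine (isCompact_closedBall (0 : ℂ) 1).eventually_forall_of_forall_eventually ?_
    intro τ hτ
    exact hφ.continuousAt.eventually_mem (hD.mem_nhds (ht τ hτ))
  have hV : IsOpen {t : ℝ | ∀ τ, ‖τ‖ ≤ 1 → φ t τ ∈ F}ᶜ := by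
    rw [isOpen_compl_iff]
    have : {t : ℝ | ∀ τ, ‖τ‖ ≤ 1 → φ t τ ∈ F} =
        ⋂ (τ : ℂ) (_ : ‖τ‖ ≤ 1), {t : ℝ | φ t τ ∈ F} := by
      ext t; simp
    rw [this]
    refine isClosed_iInter fun τ => isClosed_iInter fun _ => hF.preimage ?_
    exact hφ.comp (by fun_prop : Continuous fun t : ℝ => (t, τ))
  obtain ⟨t, ht, htU, htV⟩ := isPreconnected_Icc (a := (0 : ℝ)) (b := 1) _ _ hU hV
    (fun t ht => by
      by_contra hne
      rw [mem_union, not_or, mem_compl_iff, not_not] at hne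
      exact hne.1 fun τ hτ => hFD (hne.2 τ (by simpa using hτ)))
    ⟨0, by simp, fun τ hτ => h0 τ (by simpa using hτ)⟩
    ⟨t₁, ht₁, fun hc => hn (hFD (hc τ₁ hτ₁))⟩
  exact htV (h t ht fun τ hτ => htU τ (by simpa using hτ))

theorem ContinuityPrinciple.iUnion_of_directed {n : ℕ} {ι : Type*} [Nonempty ι] {G : ι → Set (Cn n)}
    (hG : ∀ i, IsOpen (G i)) (hdir : Directed (· ⊆ ·) G) (h : ∀ i, ContinuityPrinciple (G i)) :
    ContinuityPrinciple (⋃ i, G i) := by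
  intro φ hφ hd h0 hbd
  -- All the data of the continuity principle, the initial disc and the moving boundary circles, lie
  -- in one compact set, hence in one member of the directed family.
  set K : Set (Cn n) := φ 0 '' closedBall 0 1 ∪
    (fun p : ℝ × ℂ => φ p.1 p.2) '' (Icc 0 1 ×ˢ sphere 0 1) with hK
  have hKc : IsCompact K := by
    refine ((isCompact_closedBall _ _).image (hd 0).continuous).union ?_
    exact (isCompact_Icc.prod (isCompact_sphere _ _)).image hφ
  have hKG : K ⊆ ⋃ i, G i := by
    rintro _ (⟨τ, hτ, rfl⟩ | ⟨⟨t, τ⟩, ⟨ht, hτ⟩, rfl⟩)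
    · exact h0 τ (by simpa using hτ)
    · exact hbd t ht τ (by simpa using hτ)
  obtain ⟨i, hi⟩ := hKc.elim_directed_cover G hG hKG hdir
  intro t ht τ hτ
  refine mem_iUnion_of_mem i (h i φ hφ hd ?_ ?_ t ht τ hτ)
  · intro τ hτ
    exact hi (Or.inl ⟨τ, by simpa using hτ, rfl⟩)
  · intro t ht τ hτ
    exact hi (Or.inr ⟨(t, τ), ⟨ht, by simpa using hτ⟩, rfl⟩)

/-- The sublevel set `{u < 0}` of a continuous function obeying the maximum principle on it
satisfies the continuity principle. -/
theorem continuityPrinciple_setOf_neg {n : ℕ} {u : Cn n → ℝ} (huc : Continuous u)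
    (hu : HasMaxPrincipleOn u {z | u z < 0}) : ContinuityPrinciple {z | u z < 0} := by
  intro φ hφ hd h0 hbd
  have huφ : Continuous fun p : ℝ × ℂ => u (φ p.1 p.2) := huc.comp hφ
  obtain ⟨⟨s, σ⟩, ⟨hs, hσ⟩, hmax⟩ :=
    ((isCompact_Icc (a := (0 : ℝ)) (b := 1)).prod (isCompact_sphere (0 : ℂ) 1)).exists_isMaxOn
    ⟨(0, 1), by simp⟩ huφ.continuousOn
  have hneg : u (φ s σ) < 0 := hbd s hs σ (by simpa using hσ)
  refine forall_disc_mem_of_isClosed (isOpen_lt huc continuous_const)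
    (isClosed_le huc (continuous_const (y := u (φ s σ)))) (fun z hz => lt_of_le_of_lt hz hneg)
    hφ h0 ?_
  intro t ht hin
  refine hu.le_of_le_on_circle (hd t) (huc.comp (hd t).continuous).continuousOn ?_
    (fun τ hτ _ => hin τ hτ)
  intro τ hτ
  exact hmax (a := (t, τ)) ⟨ht, by simpa using hτ⟩

/-- The ball is itself a sublevel set of a plurisubharmonic function, so the intersection is the
negativity set of a maximum of two functions obeying the maximum principle. -/
theorem continuityPrinciple_ball_inter_setOf_neg {n : ℕ} {ρ : Cn n → ℝ} {b : Cn n} {r : ℝ}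
    (hr : 0 < r) (hρ : ContDiff ℝ 2 ρ) (hL : ∀ z ∈ ball b r, ∀ w, 0 ≤ leviForm ρ z w) :
    ContinuityPrinciple (ball b r ∩ {z | ρ z < 0}) := by
  have hmem : ∀ z, ‖z - b‖ ^ 2 - r ^ 2 < 0 ↔ z ∈ ball b r := by
    intro z
    rw [mem_ball_iff_norm, sub_neg, sq_lt_sq₀ (norm_nonneg _) hr.le]
  have hset : ball b r ∩ {z | ρ z < 0} = {z | max (ρ z) (‖z - b‖ ^ 2 - r ^ 2) < 0} := by
    ext z
    simp only [mem_inter_iff, mem_ofPred_eq, max_lt_iff, hmem]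
    tauto
  rw [hset]
  refine continuityPrinciple_setOf_neg (hρ.continuous.max (by fun_prop)) ?_
  have h1 := hasMaxPrincipleOn_of_leviForm_nonneg (W := {z | max (ρ z) (‖z - b‖ ^ 2 - r ^ 2) < 0})
    hρ (fun z hz => hL z ((hmem z).1 (max_lt_iff.1 hz).2))
  have h2 := (submeanOn_norm_sub_sq_sub b (r ^ 2)).hasMaxPrincipleOn isOpen_univ (by fun_prop)
  exact h1.max fun φ hφ τ _ => h2 φ hφ τ (mem_univ _)

/-! ### From the continuity principle to pseudoconvexity -/

/-- Continuous real functions on the unit circle are uniform limits of real parts of entire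
functions. -/
theorem exists_differentiable_re_approx {g : ℂ → ℝ} (hg : ContinuousOn g (sphere 0 1)) {ε : ℝ}
    (hε : 0 < ε) :
    ∃ f : ℂ → ℂ, Differentiable ℂ f ∧ ∀ ζ : ℂ, ‖ζ‖ = 1 → |(f ζ).re - g ζ| < ε := by
  have : Fact (0 < 2 * Real.pi) := ⟨Real.two_pi_pos⟩
  have hcirc : Continuous fun x : AddCircle (2 * Real.pi) => (AddCircle.toCircle x : ℂ) :=
    continuous_subtype_val.comp AddCircle.continuous_toCircle
  let G : C(AddCircle (2 * Real.pi), ℂ) :=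
    ⟨fun x => (g (AddCircle.toCircle x : ℂ) : ℂ), Complex.continuous_ofReal.comp
      (hg.comp_continuous hcirc fun x => mem_sphere_zero_iff_norm.2 (Circle.norm_coe _))⟩
  have hG : G ∈ closure (Submodule.span ℂ (range (@fourier (2 * Real.pi))) :
      Set C(AddCircle (2 * Real.pi), ℂ)) := by
    have h := span_fourier_closure_eq_top (T := 2 * Real.pi)
    have h2 : G ∈ (Submodule.span ℂ (range (@fourier (2 * Real.pi)))).topologicalClosure := by
      rw [h]; trivial
    exact h2
  obtain ⟨h, hh, hdist⟩ := Metric.mem_closure_iff.1 hG ε hε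
  have hspan : ∃ p q : ℂ → ℂ, Differentiable ℂ p ∧ Differentiable ℂ q ∧
      ∀ x, h x = p (AddCircle.toCircle x) + starRingEnd ℂ (q (AddCircle.toCircle x)) := by
    refine Submodule.span_induction (p := fun h _ => ∃ p q : ℂ → ℂ, Differentiable ℂ p ∧
      Differentiable ℂ q ∧ ∀ x, h x = p (AddCircle.toCircle x) +
        starRingEnd ℂ (q (AddCircle.toCircle x))) ?_ ?_ ?_ ?_ hh
    · rintro _ ⟨k, rfl⟩
      rcases Int.le_total 0 k with hk | hk
      · obtain ⟨m, rfl⟩ := Int.eq_ofNat_of_zero_le hk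
        refine ⟨fun z => z ^ m, fun _ => 0, by fun_prop, by fun_prop, fun x => ?_⟩
        simp [fourier_apply, AddCircle.toCircle_nsmul]
      · obtain ⟨m, hm⟩ := Int.eq_ofNat_of_zero_le (neg_nonneg.2 hk)
        obtain rfl : k = -(m : ℤ) := by omega
        refine ⟨fun _ => 0, fun z => z ^ m, by fun_prop, by fun_prop, fun x => ?_⟩
        rw [fourier_neg]
        simp [fourier_apply, AddCircle.toCircle_nsmul]
    · exact ⟨fun _ => 0, fun _ => 0, by fun_prop, by fun_prop, by simp⟩
    · rintro a b _ _ ⟨p, q, hp, hq, ha⟩ ⟨p', q', hp', hq', hb⟩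
      refine ⟨fun z => p z + p' z, fun z => q z + q' z, hp.add hp', hq.add hq', fun x => ?_⟩
      simp only [ContinuousMap.add_apply, ha, hb, map_add]
      ring
    · rintro c a _ ⟨p, q, hp, hq, ha⟩
      refine ⟨fun z => c * p z, fun z => starRingEnd ℂ c * q z, hp.const_mul c,
        hq.const_mul _, fun x => ?_⟩
      simp only [ContinuousMap.smul_apply, ha, smul_eq_mul, map_mul, Complex.conj_conj]
      ring
  obtain ⟨p, q, hp, hq, hpq⟩ := hspan
  -- Removing the conjugation from `q` leaves the real part unchanged and makes the function entire.
  refine ⟨fun z => p z + q z, hp.add hq, fun ζ hζ => ?_⟩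
  obtain ⟨x, hx⟩ := (AddCircle.homeomorphCircle (T := 2 * Real.pi) Real.two_pi_pos.ne').surjective
    ⟨ζ, by simpa [Submonoid.unitSphere] using hζ⟩
  have hx' : (AddCircle.toCircle x : ℂ) = ζ := by
    rw [AddCircle.homeomorphCircle_apply] at hx
    rw [hx]
  have h1 : dist (G x) (h x) < ε := lt_of_le_of_lt (ContinuousMap.dist_apply_le_dist x) hdist
  have h2 : (h x).re = (p ζ + q ζ).re := by
    rw [hpq, hx']; simp
  have h3 : (G x).re = g ζ := by
    change ((g (AddCircle.toCircle x : ℂ) : ℂ)).re = _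
    rw [hx', Complex.ofReal_re]
  rw [← h2, ← h3, ← Complex.sub_re]
  rw [dist_comm, dist_eq_norm] at h1
  exact (Complex.abs_re_le_norm _).trans_lt h1

theorem infDist_compl_pos {X : Type*} [PseudoMetricSpace X] {D : Set X}
    (hD : IsOpen D) (hne : Dᶜ.Nonempty) {z : X} (hz : z ∈ D) : 0 < infDist z Dᶜ :=
  (hD.isClosed_compl.notMem_iff_infDist_pos hne).1 (by simpa using hz)

theorem continuousOn_neg_log_infDist_compl {X : Type*} [PseudoMetricSpace X] {D : Set X}
    (hD : IsOpen D) (hne : Dᶜ.Nonempty) :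
    ContinuousOn (fun z => -Real.log (infDist z Dᶜ)) D := by
  refine (ContinuousOn.log (continuous_infDist_pt _).continuousOn fun z hz => ?_).neg
  exact (infDist_compl_pos hD hne hz).ne'

theorem isPseudoconvex_univ {n : ℕ} : IsPseudoconvex (univ : Set (Cn n)) := by
  refine ⟨isOpen_univ, ?_, ?_⟩
  · simp only [compl_univ, infDist_empty, Real.log_zero, neg_zero]
    exact upperSemicontinuousOn_const
  · intro z w _
    simp only [compl_univ, infDist_empty, Real.log_zero, neg_zero]
    exact ⟨circleIntegrable_const _ _ _, by rw [Real.circleAverage_const]⟩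

/-- Choose `p` entire with `Re p` slightly above `-log dist` on the boundary circle of the given
disc. Translating the disc by `t e^{-p(τ)} a` with `‖a‖ < 1` and `0 ≤ t ≤ 1` keeps its boundary in
`D`, so the translated centres stay in `D` and fill the ball of radius `e^{-Re p(0)}` about `z`.
This bounds `-log dist` at `z` by `Re p(0)`, the circle average of `Re p`. -/
theorem ContinuityPrinciple.isPseudoconvex {n : ℕ} {D : Set (Cn n)} (h : ContinuityPrinciple D)
    (hD : IsOpen D) : IsPseudoconvex D := by
  rcases eq_empty_or_nonempty Dᶜ with he | hne
  · rw [compl_empty_iff] at he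
    subst he
    exact isPseudoconvex_univ
  have hcont := continuousOn_neg_log_infDist_compl hD hne
  refine ⟨hD, hcont.upperSemicontinuousOn, ?_⟩
  intro z w hzw
  set g : ℂ → ℝ := fun ζ => -Real.log (infDist (z + ζ • w) Dᶜ) with hg
  have hgc : ContinuousOn g (sphere 0 1) := by
    refine hcont.comp (f := fun ζ : ℂ => z + ζ • w) (by fun_prop) fun ζ hζ => hzw ζ ?_
    rw [mem_sphere_zero_iff_norm] at hζ
    exact hζ.le
  have hgint : CircleIntegrable g 0 1 := hgc.circleIntegrable zero_le_one
  refine ⟨hgint, ?_⟩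
  have hz : z ∈ D := by simpa using hzw 0 (by simp)
  refine le_of_forall_pos_le_add fun ε hε => ?_
  obtain ⟨f, hf, hfg⟩ := exists_differentiable_re_approx hgc (half_pos hε)
  set p : ℂ → ℂ := fun ζ => f ζ + ((ε / 2 : ℝ) : ℂ) with hp
  have hpd : Differentiable ℂ p := hf.add_const _
  have hpre : ∀ ζ, (p ζ).re = (f ζ).re + ε / 2 := by
    intro ζ; simp only [hp, Complex.add_re, Complex.ofReal_re]
  have hpavg : (p 0).re ≤ Real.circleAverage g 0 1 + ε := by
    rw [← circleAverage_re_of_differentiable hpd 0 1,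
      ← Real.circleAverage_const ε 0 1, ← Real.circleAverage_fun_add hgint
        (circleIntegrable_const _ _ _)]
    refine Real.circleAverage_mono
      (Complex.continuous_re.comp hpd.continuous).continuousOn.circleIntegrable'
      (hgint.add (circleIntegrable_const _ _ _)) fun ζ hζ => ?_
    have := (abs_lt.1 (hfg ζ (by simpa using hζ))).2
    rw [hpre]
    linarith
  refine le_trans ?_ hpavg
  have hball : ball z (Real.exp (-(p 0).re)) ⊆ D := by
    intro y hy
    -- Normalized so that the disc at time `1` has centre `y`.
    set a : Cn n := Complex.exp (p 0) • (y - z) with ha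
    have ha1 : ‖a‖ < 1 := by
      rw [mem_ball_iff_norm] at hy
      rw [ha, norm_smul, Complex.norm_exp]
      calc Real.exp (p 0).re * ‖y - z‖ < Real.exp (p 0).re * Real.exp (-(p 0).re) := by gcongr
        _ = 1 := by rw [← Real.exp_add]; simp
    set φ : ℝ → ℂ → Cn n := fun t τ => z + τ • w + ((t : ℂ) * Complex.exp (-p τ)) • a with hφ
    have hφc : Continuous fun q : ℝ × ℂ => φ q.1 q.2 := by
      have := hpd.continuous
      fun_prop
    have hφd : ∀ t, Differentiable ℂ (φ t) := by
      intro t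
      have : Differentiable ℂ fun τ => Complex.exp (-p τ) := hpd.neg.cexp
      fun_prop
    have hbd : ∀ t ∈ Icc (0 : ℝ) 1, ∀ τ, ‖τ‖ = 1 → φ t τ ∈ D := by
      intro t ht τ hτ
      have hpos := infDist_compl_pos hD hne (hzw τ hτ.le)
      refine ball_infDist_compl_subset (x := z + τ • w) ?_
      rw [mem_ball_iff_norm]
      have h1 : φ t τ - (z + τ • w) = ((t : ℂ) * Complex.exp (-p τ)) • a := by
        simp only [hφ]; abel
      rw [h1, norm_smul, norm_mul, Complex.norm_real, Complex.norm_exp, Real.norm_of_nonneg ht.1]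
      have h2 : Real.exp (-p τ).re ≤ infDist (z + τ • w) Dᶜ := by
        rw [← Real.exp_log hpos, Real.exp_le_exp, Complex.neg_re, hpre]
        have := (abs_lt.1 (hfg τ hτ)).1
        simp only [hg] at this
        linarith
      have h3 : 0 < Real.exp (-p τ).re := Real.exp_pos _
      calc t * Real.exp (-p τ).re * ‖a‖ ≤ 1 * Real.exp (-p τ).re * ‖a‖ := by
            gcongr; exact ht.2
        _ < 1 * Real.exp (-p τ).re * 1 := by gcongr
        _ ≤ infDist (z + τ • w) Dᶜ := by simpa using h2
    have := h φ hφc hφd (fun τ hτ => by simpa [hφ] using hzw τ hτ) hbd 1 (by simp) 0 (by simp)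
    have h4 : φ 1 0 = y := by
      simp only [hφ, ha, zero_smul, add_zero, Complex.ofReal_one, one_mul, smul_smul,
        ← Complex.exp_add]
      simp
    rwa [h4] at this
  have hle : Real.exp (-(p 0).re) ≤ infDist z Dᶜ := by
    refine (le_infDist hne).2 fun y hy => ?_
    by_contra! hlt
    exact hy (hball (by rwa [mem_ball, dist_comm]))
  have := Real.log_le_log (Real.exp_pos _) hle
  rw [Real.log_exp] at this
  linarith

/-! ### From local to global pseudoconvexity -/

theorem IsPseudoconvex.hasMaxPrincipleOn {n : ℕ} {D : Set (Cn n)} (hD : IsPseudoconvex D)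
    (hne : Dᶜ.Nonempty) : HasMaxPrincipleOn (fun z => -Real.log (infDist z Dᶜ)) D :=
  SubmeanOn.hasMaxPrincipleOn hD.1 (continuousOn_neg_log_infDist_compl hD.1 hne) hD.2.2

/-- Since `b` lies in both complements, a point within `r / 2` of `b` is at distance less than `r /
2` from each, and complement points that close to it lie in `ball b r`, where the two sets agree. -/
theorem infDist_compl_eq_of_inter_ball_eq {X : Type*} [PseudoMetricSpace X] {D G : Set X} {b z : X}
    {r : ℝ} (hDG : D ∩ ball b r = G ∩ ball b r) (hb : b ∉ D) (hz : z ∈ ball b (r / 2)) :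
    infDist z Dᶜ = infDist z Gᶜ := by
  have key : ∀ {D G : Set X}, D ∩ ball b r = G ∩ ball b r → b ∉ D → infDist z Gᶜ ≤ infDist z Dᶜ := by
    intro D G hDG hb
    have hr : 0 < r := by
      have := dist_nonneg.trans_lt (mem_ball.1 hz)
      linarith
    have hbG : b ∉ G := fun h => hb (hDG.symm.subset ⟨h, mem_ball_self hr⟩).1
    refine (le_infDist ⟨b, hb⟩).2 fun y hy => ?_
    rcases lt_or_ge (dist z y) (r / 2) with hlt | hge
    · refine infDist_le_dist_of_mem fun hyG => hy (hDG.symm.subset ⟨hyG, ?_⟩).1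
      have := dist_triangle_left y b z
      rw [mem_ball] at hz ⊢
      linarith
    · exact (infDist_le_dist_of_mem hbG).trans ((mem_ball.1 hz).le.trans hge)
  have hbG : b ∉ G := fun h => hb (hDG.symm.subset ⟨h, by
    have := dist_nonneg.trans_lt (mem_ball.1 hz)
    exact mem_ball_self (by linarith)⟩).1
  exact le_antisymm (key hDG.symm hbG) (key hDG hb)

/-- An open set that is pseudoconvex near each of its boundary points satisfies the continuity
principle. -/
theorem continuityPrinciple_of_locally_isPseudoconvex {n : ℕ} {D : Set (Cn n)} (hD : IsOpen D)
    (hloc : ∀ b ∈ frontier D, ∃ r > 0, ∃ G, IsPseudoconvex G ∧ D ∩ ball b r = G ∩ ball b r) :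
    ContinuityPrinciple D := by
  rcases eq_empty_or_nonempty Dᶜ with he | hne
  · rw [compl_empty_iff] at he
    subst he
    exact fun φ _ _ _ _ t _ τ _ => mem_univ _
  choose! r hr G hG hDG using hloc
  set u : Cn n → ℝ := fun z => -Real.log (infDist z Dᶜ) with hu
  set W : Set (Cn n) := ⋃ b ∈ frontier D, ball b (r b / 2) with hW
  have hWo : IsOpen W := isOpen_biUnion fun b _ => isOpen_ball
  have hfW : frontier D ⊆ W := fun b hb =>
    mem_biUnion hb (mem_ball_self (half_pos (hr b hb)))
  have hmax : HasMaxPrincipleOn u (D ∩ W) := by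
    rintro φ hφ τ ⟨hτD, hτW⟩ ε hε hloc
    obtain ⟨b, hb, hτb⟩ := mem_iUnion₂.1 hτW
    have hbD : b ∉ D := by
      rw [hD.frontier_eq] at hb; exact hb.2
    have hbG : b ∉ G b := fun h => hbD ((hDG b hb).symm.subset ⟨h, mem_ball_self (hr b hb)⟩).1
    have hτG : φ τ ∈ G b := ((hDG b hb).subset ⟨hτD, ball_subset_ball
      (by linarith [hr b hb]) hτb⟩).1
    refine (hG b hb).hasMaxPrincipleOn ⟨b, hbG⟩ φ hφ τ hτG ε hε (hloc.congr ?_)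
    filter_upwards [hφ.continuous.continuousAt.eventually_mem (isOpen_ball.mem_nhds hτb)] with s hs
    simp only [hu]
    rw [infDist_compl_eq_of_inter_ball_eq (hDG b hb) hbD hs]
  intro φ hφ hd h0 hbd
  have hIc : Continuous fun z : Cn n => infDist z Dᶜ := continuous_infDist_pt _
  have hlow : ∀ K : Set (Cn n), IsCompact K → K ⊆ D → ∃ m > 0, ∀ z ∈ K, m ≤ infDist z Dᶜ := by
    intro K hK hKD
    rcases K.eq_empty_or_nonempty with rfl | hKne
    · exact ⟨1, one_pos, by simp⟩
    obtain ⟨x, hx, hmin⟩ := hK.exists_isMinOn hKne hIc.continuousOn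
    exact ⟨_, infDist_compl_pos hD hne (hKD hx), fun z hz => hmin hz⟩
  set X : Set (Cn n) := (fun p : ℝ × ℂ => φ p.1 p.2) '' (Icc 0 1 ×ˢ closedBall 0 1) with hX
  have hXc : IsCompact X := (isCompact_Icc.prod (isCompact_closedBall _ _)).image hφ
  -- Away from `W` the discs stay a fixed distance from the complement, so the maximum principle is
  -- needed only inside `W`, where it is available.
  obtain ⟨η, hη, hηX⟩ := hlow ((X ∩ closure D) \ W) ((hXc.inter_right isClosed_closure).diff hWo)
    (fun z hz => by
      by_contra hzD
      exact hz.2 (hfW (by rw [hD.frontier_eq]; exact ⟨hz.1.2, hzD⟩)))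
  obtain ⟨κ, hκ, hκB⟩ := hlow ((fun p : ℝ × ℂ => φ p.1 p.2) '' (Icc 0 1 ×ˢ sphere 0 1))
    ((isCompact_Icc.prod (isCompact_sphere _ _)).image hφ) (by
      rintro _ ⟨⟨t, τ⟩, ⟨ht, hτ⟩, rfl⟩
      exact hbd t ht τ (by simpa using hτ))
  set m := min η κ with hm
  have hmpos : 0 < m := lt_min hη hκ
  refine forall_disc_mem_of_isClosed hD (F := {z | m ≤ infDist z Dᶜ})
    (isClosed_le continuous_const hIc) ?_ hφ h0 ?_
  · intro z hz
    by_contra hzD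
    have : infDist z Dᶜ = 0 := infDist_zero_of_mem hzD
    rw [mem_ofPred_eq, this] at hz
    linarith
  · intro t ht hin τ hτ
    have hcu : ContinuousOn (fun τ => u (φ t τ)) (closedBall 0 1) :=
      (continuousOn_neg_log_infDist_compl hD hne).comp (hd t).continuous.continuousOn
        fun τ hτ => hin τ (by simpa using hτ)
    have hpos : ∀ τ, ‖τ‖ ≤ 1 → 0 < infDist (φ t τ) Dᶜ := fun τ hτ =>
      infDist_compl_pos hD hne (hin τ hτ)
    have := hmax.le_of_le_on_circle (hd t) hcu (c := -Real.log m) ?_ ?_ τ hτ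
    · exact (Real.log_le_log_iff hmpos (hpos τ hτ)).1 (neg_le_neg_iff.1 this)
    · intro τ hτ
      refine neg_le_neg (Real.log_le_log hmpos ((min_le_right _ _).trans (hκB _ ?_)))
      exact ⟨(t, τ), ⟨ht, by simpa using hτ⟩, rfl⟩
    · intro τ hτ hlt
      refine ⟨hin τ hτ, ?_⟩
      by_contra hnW
      have h1 : infDist (φ t τ) Dᶜ < m :=
        (Real.log_lt_log_iff (hpos τ hτ) hmpos).1 (neg_lt_neg_iff.1 hlt)
      have h2 := hηX (φ t τ) ⟨⟨⟨(t, τ), ⟨ht, by simpa using hτ⟩, rfl⟩,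
        subset_closure (hin τ hτ)⟩, hnW⟩
      exact absurd ((min_le_left η κ).trans h2) (not_le.2 h1)

/-! ### Calculus of the Levi form -/

theorem fderiv_fderiv_mul_apply {E : Type*} [NormedAddCommGroup E] [NormedSpace ℝ E] {f g : E → ℝ}
    (hf : ContDiff ℝ 2 f) (hg : ContDiff ℝ 2 g) (a v w : E) :
    fderiv ℝ (fderiv ℝ fun z => f z * g z) a v w =
      f a * fderiv ℝ (fderiv ℝ g) a v w + fderiv ℝ f a v * fderiv ℝ g a w +
        g a * fderiv ℝ (fderiv ℝ f) a v w + fderiv ℝ g a v * fderiv ℝ f a w := by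
  have hfd : Differentiable ℝ f := hf.differentiable (by norm_num)
  have hgd : Differentiable ℝ g := hg.differentiable (by norm_num)
  have hfd' : Differentiable ℝ (fderiv ℝ f) :=
    (hf.fderiv_right (m := 1) (by norm_num)).differentiable (by norm_num)
  have hgd' : Differentiable ℝ (fderiv ℝ g) :=
    (hg.fderiv_right (m := 1) (by norm_num)).differentiable (by norm_num)
  have h1 : (fderiv ℝ fun z => f z * g z) = fun z => f z • fderiv ℝ g z + g z • fderiv ℝ f z :=
    funext fun z => fderiv_fun_mul (hfd z) (hgd z)
  have h2 := ((hfd a).hasFDerivAt.smul (hgd' a).hasFDerivAt).add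
    ((hgd a).hasFDerivAt.smul (hfd' a).hasFDerivAt)
  rw [h1]
  erw [h2.fderiv]
  simp
  ring

theorem leviForm_mul {n : ℕ} {f g : Cn n → ℝ} (hf : ContDiff ℝ 2 f) (hg : ContDiff ℝ 2 g)
    {a : Cn n} (ha : g a = 0) (w : Cn n) :
    leviForm (fun z => f z * g z) a w = f a * leviForm g a w +
      (fderiv ℝ f a w * fderiv ℝ g a w +
        fderiv ℝ f a (Complex.I • w) * fderiv ℝ g a (Complex.I • w)) / 2 := by
  rw [leviForm, fderiv_fderiv_mul_apply hf hg, fderiv_fderiv_mul_apply hf hg, ha, leviForm]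
  ring

theorem leviForm_sum {n : ℕ} {ι : Type*} {t : Finset ι} {f : ι → Cn n → ℝ}
    (hf : ∀ i ∈ t, ContDiff ℝ 2 (f i)) (a w : Cn n) :
    leviForm (fun z => ∑ i ∈ t, f i z) a w = ∑ i ∈ t, leviForm (f i) a w := by
  have h1 : (fderiv ℝ fun z => ∑ i ∈ t, f i z) = fun z => ∑ i ∈ t, fderiv ℝ (f i) z :=
    funext fun z => fderiv_fun_sum fun i hi => (hf i hi).differentiable (by norm_num) z
  have h2 : fderiv ℝ (fun z => ∑ i ∈ t, fderiv ℝ (f i) z) a =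
      ∑ i ∈ t, fderiv ℝ (fderiv ℝ (f i)) a := fderiv_fun_sum fun i hi =>
    ((hf i hi).fderiv_right (m := 1) (by norm_num)).differentiable (by norm_num) a
  simp only [leviForm, h1, h2, _root_.sum_apply, ← Finset.sum_div,
    Finset.sum_add_distrib]

theorem leviForm_sub_const_mul {n : ℕ} {f g : Cn n → ℝ} (hf : ContDiff ℝ 2 f) (hg : ContDiff ℝ 2 g)
    (ε : ℝ) (a w : Cn n) :
    leviForm (fun z => f z - ε * g z) a w = leviForm f a w - ε * leviForm g a w := by
  have hfd : Differentiable ℝ f := hf.differentiable (by norm_num)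
  have hgd : Differentiable ℝ g := hg.differentiable (by norm_num)
  have hfd' : Differentiable ℝ (fderiv ℝ f) :=
    (hf.fderiv_right (m := 1) (by norm_num)).differentiable (by norm_num)
  have hgd' : Differentiable ℝ (fderiv ℝ g) :=
    (hg.fderiv_right (m := 1) (by norm_num)).differentiable (by norm_num)
  have h1 : (fderiv ℝ fun z => f z - ε * g z) = fun z => fderiv ℝ f z - ε • fderiv ℝ g z :=
    funext fun z => ((hfd z).hasFDerivAt.sub ((hgd z).hasFDerivAt.const_mul ε)).fderiv
  have h2 : fderiv ℝ (fun z => fderiv ℝ f z - ε • fderiv ℝ g z) a =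
      fderiv ℝ (fderiv ℝ f) a - ε • fderiv ℝ (fderiv ℝ g) a :=
    ((hfd' a).hasFDerivAt.sub ((hgd' a).hasFDerivAt.const_smul ε)).fderiv
  simp only [leviForm, h1, h2, _root_.sub_apply, _root_.smul_apply,
    smul_eq_mul]
  ring

theorem leviForm_congr {n : ℕ} {f g : Cn n → ℝ} {a : Cn n} (h : f =ᶠ[𝓝 a] g) (w : Cn n) :
    leviForm f a w = leviForm g a w := by
  simp only [leviForm, h.fderiv.fderiv_eq]

theorem leviForm_smul {n : ℕ} (f : Cn n → ℝ) (a : Cn n) (c : ℝ) (w : Cn n) :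
    leviForm f a (c • w) = c ^ 2 * leviForm f a w := by
  rw [leviForm, leviForm, smul_comm Complex.I c w]
  simp only [map_smul, _root_.smul_apply, smul_eq_mul]
  ring

theorem continuous_leviForm {n : ℕ} {f : Cn n → ℝ} (hf : ContDiff ℝ 2 f) :
    Continuous fun p : Cn n × Cn n => leviForm f p.1 p.2 := by
  have h1 : Continuous (fderiv ℝ (fderiv ℝ f)) :=
    (hf.fderiv_right (m := 1) (by norm_num)).continuous_fderiv (by norm_num)
  have h2 : Continuous fun p : Cn n × Cn n => Complex.I • p.2 := by fun_prop
  have h3 : Continuous fun p : Cn n × Cn n => fderiv ℝ (fderiv ℝ f) p.1 := h1.comp continuous_fst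
  exact (((h3.clm_apply continuous_snd).clm_apply continuous_snd).add
    ((h3.clm_apply h2).clm_apply h2)).div_const 4

/-- Replacing `ρ` by `ρ + Cρ²` makes the Levi form positive definite in all directions. -/
theorem exists_leviForm_pos {n : ℕ} {ρ : Cn n → ℝ} (hρ : ContDiff ℝ 2 ρ) {K : Set (Cn n)}
    (hK : IsCompact K) (h0 : ∀ a ∈ K, ρ a = 0)
    (hL : ∀ a ∈ K, ∀ w, w ≠ 0 → fderiv ℝ ρ a w = 0 → fderiv ℝ ρ a (Complex.I • w) = 0 →
      0 < leviForm ρ a w) :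
    ∃ C : ℝ, 0 ≤ C ∧ ∀ a ∈ K, ∀ w, w ≠ 0 → 0 < leviForm (fun z => (1 + C * ρ z) * ρ z) a w := by
  have hfc : Continuous (fderiv ℝ ρ) := hρ.continuous_fderiv (by norm_num)
  have hfc' : Continuous fun p : Cn n × Cn n => fderiv ℝ ρ p.1 := hfc.comp continuous_fst
  have hI : Continuous fun p : Cn n × Cn n => Complex.I • p.2 := by fun_prop
  obtain ⟨C, hC, hneg⟩ := exists_forall_sub_mul_neg (hK.prod (isCompact_sphere (0 : Cn n) 1))
    (f := fun p => -leviForm ρ p.1 p.2)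
    (g := fun p => (fderiv ℝ ρ p.1 p.2 ^ 2 + fderiv ℝ ρ p.1 (Complex.I • p.2) ^ 2) / 2)
    (continuous_leviForm hρ).neg.continuousOn
    ((((hfc'.clm_apply continuous_snd).pow 2).add
      ((hfc'.clm_apply hI).pow 2)).div_const 2).continuousOn
    (fun p _ => by positivity) (by
      rintro ⟨a, w⟩ ⟨ha, hw⟩ hg
      have hw1 : w ≠ 0 := by
        rintro rfl
        simp at hw
      simp only at hg
      have h1 := sq_nonneg (fderiv ℝ ρ a w)
      have h2 := sq_nonneg (fderiv ℝ ρ a (Complex.I • w))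
      have := hL a ha w hw1 (pow_eq_zero_iff two_ne_zero |>.1 (by linarith))
        (pow_eq_zero_iff two_ne_zero |>.1 (by linarith))
      simpa using this)
  refine ⟨C, hC, fun a ha w hw => ?_⟩
  have hρd : Differentiable ℝ ρ := hρ.differentiable (by norm_num)
  have hd : fderiv ℝ (fun z => 1 + C * ρ z) a = C • fderiv ℝ ρ a :=
    (((hρd a).hasFDerivAt.const_mul C).const_add 1).fderiv
  have key : ∀ v, ‖v‖ = 1 → 0 < leviForm (fun z => (1 + C * ρ z) * ρ z) a v := by
    intro v hv
    have := hneg (a, v) ⟨ha, by simpa using hv⟩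
    -- At a zero of `ρ`, the Levi form of `ρ + C ρ²` is that of `ρ` plus `C / 2` times the sum of
    -- squares of `dρ(v)` and `dρ(iv)`.
    rw [leviForm_mul (by fun_prop) hρ (h0 a ha), hd, h0 a ha]
    simp only [_root_.smul_apply, smul_eq_mul]
    nlinarith
  have hw0 : 0 < ‖w‖ := norm_pos_iff.2 hw
  have h1 := key (‖w‖⁻¹ • w) (by rw [norm_smul, norm_inv, norm_norm, inv_mul_cancel₀ hw0.ne'])
  rw [leviForm_smul] at h1
  exact pos_of_mul_pos_right h1 (by positivity)

/-- Homogeneity of degree two reduces the bound to the unit sphere; compactness of `K` and of the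
sphere gives the constant and the neighbourhood. -/
theorem exists_le_leviForm_nhds {n : ℕ} {ρ : Cn n → ℝ} (hρ : ContDiff ℝ 2 ρ) {K : Set (Cn n)}
    (hK : IsCompact K) (hL : ∀ a ∈ K, ∀ w, w ≠ 0 → 0 < leviForm ρ a w) :
    ∃ c > 0, ∃ V, IsOpen V ∧ K ⊆ V ∧ ∀ z ∈ V, ∀ w, c * ‖w‖ ^ 2 ≤ leviForm ρ z w := by
  have hc := continuous_leviForm hρ
  have hS := isCompact_sphere (0 : Cn n) 1
  obtain ⟨c, hc0, hcK⟩ : ∃ c > 0, ∀ p ∈ K ×ˢ sphere (0 : Cn n) 1, c < leviForm ρ p.1 p.2 := by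
    rcases (K ×ˢ sphere (0 : Cn n) 1).eq_empty_or_nonempty with he | hne
    · exact ⟨1, one_pos, by simp [he]⟩
    · obtain ⟨⟨a, w⟩, ⟨ha, hw⟩, hmin⟩ := (hK.prod hS).exists_isMinOn hne hc.continuousOn
      have hpos := hL a ha w (by rintro rfl; simp at hw)
      exact ⟨leviForm ρ a w / 2, by positivity, fun p hp => lt_of_lt_of_le (by simpa using hpos)
        (hmin hp)⟩
  refine ⟨c, hc0, {z | ∀ w ∈ sphere (0 : Cn n) 1, c < leviForm ρ z w}, ?_, ?_, ?_⟩
  · rw [isOpen_iff_mem_nhds]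
    intro z hz
    refine hS.eventually_forall_of_forall_eventually fun w hw => ?_
    exact hc.continuousAt.eventually (lt_mem_nhds (hz w hw))
  · exact fun z hz w hw => hcK (z, w) ⟨hz, hw⟩
  · intro z hz w
    rcases eq_or_ne w 0 with rfl | hw
    · simp [leviForm]
    have hw0 : 0 < ‖w‖ := norm_pos_iff.2 hw
    have h1 := hz (‖w‖⁻¹ • w) (by
      rw [mem_sphere_zero_iff_norm, norm_smul, norm_inv, norm_norm, inv_mul_cancel₀ hw0.ne'])
    rw [leviForm_smul, inv_pow, ← div_eq_inv_mul, lt_div_iff₀ (by positivity)] at h1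
    exact h1.le

/-! ### Strictly plurisubharmonic defining functions -/

theorem eq_zero_of_mem_frontier {X : Type*} [TopologicalSpace X] {D V : Set X} {ρ : X → ℝ}
    (hD : IsOpen D) (hV : IsOpen V) (hρ : ContinuousOn ρ V) (hs : ∀ z ∈ V, z ∈ D ↔ ρ z < 0)
    {a : X} (ha : a ∈ frontier D) (haV : a ∈ V) : ρ a = 0 := by
  rw [hD.frontier_eq] at ha
  refine le_antisymm ?_ (not_lt.1 fun h => ha.2 ((hs a haV).2 h))
  by_contra! hpos
  have h1 := (hρ.continuousAt (hV.mem_nhds haV)).eventually (lt_mem_nhds hpos)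
  obtain ⟨z, ⟨hz1, hz2⟩, hzD⟩ := mem_closure_iff_nhds.1 ha.1 _ (h1.and (hV.mem_nhds haV))
  exact lt_asymm ((hs z hz2).1 hzD) hz1

theorem one_add_mul_mul_neg_iff {C x : ℝ} (h : 0 < 1 + C * x) : (1 + C * x) * x < 0 ↔ x < 0 :=
  ⟨fun h' => by
    by_contra! hx
    exact absurd (mul_nonneg h.le hx) (not_le.2 h'), fun hx => mul_neg_of_pos_of_neg h hx⟩

/-- Near a strongly pseudoconvex boundary point there is a globally defined `C²` function that is
strictly plurisubharmonic and defines `D` near the point. -/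
theorem exists_local_defining_function {n : ℕ} {D : Set (Cn n)} (hD : IsOpen D) {a : Cn n}
    (ha : a ∈ stronglyPseudoconvexPoints D) :
    ∃ r > 0, ∃ ρ : Cn n → ℝ, ContDiff ℝ 2 ρ ∧ (∀ z ∈ ball a r, z ∈ D ↔ ρ z < 0) ∧
      ∀ z ∈ ball a r, ∀ w, w ≠ 0 → 0 < leviForm ρ z w := by
  obtain ⟨hfr, U, ρ₀, hU, haU, hρ₀, hDU, -, hL⟩ := ha
  have hs₀ : ∀ z ∈ U, z ∈ D ↔ ρ₀ z < 0 := fun z hz =>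
    ⟨fun h => (hDU.subset ⟨h, hz⟩).2, fun h => (hDU.symm.subset ⟨hz, h⟩).1⟩
  obtain ⟨R, hR, hRU⟩ := Metric.nhds_basis_closedBall.mem_iff.1 (hU.mem_nhds haU)
  -- The cutoff makes the defining function globally `C²` without changing its germ at `a`.
  let θ : ContDiffBump a := ⟨R / 2, R, half_pos hR, half_lt_self hR⟩
  set ρ₁ : Cn n → ℝ := fun z => θ z * ρ₀ z with hρ₁
  have hρ₁c : ContDiff ℝ 2 ρ₁ := by
    refine contDiff_iff_contDiffAt.2 fun z => ?_
    by_cases hz : z ∈ tsupport θ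
    · exact θ.contDiff.contDiffAt.mul
        (hρ₀.contDiffAt (hU.mem_nhds (hRU (by rwa [θ.tsupport_eq] at hz))))
    · refine (contDiffAt_const (c := (0 : ℝ))).congr_of_eventuallyEq ?_
      filter_upwards [notMem_tsupport_iff_eventuallyEq.1 hz] with y hy
      simp [hρ₁, hy]
  have heq : ρ₁ =ᶠ[𝓝 a] ρ₀ := by
    filter_upwards [θ.eventuallyEq_one] with z hz
    simp [hρ₁, hz]
  have ha0 : ρ₁ a = 0 := by
    rw [heq.eq_of_nhds]
    exact eq_zero_of_mem_frontier hD hU hρ₀.continuousOn hs₀ hfr haU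
  obtain ⟨C, -, hC⟩ := exists_leviForm_pos hρ₁c (isCompact_singleton (x := a)) (by simpa using ha0)
    (by
      rintro _ rfl w hw h1 h2
      rw [leviForm_congr heq]
      rw [heq.fderiv_eq] at h1 h2
      exact hL w hw h1 h2)
  have hρ₂ : ContDiff ℝ 2 fun z => (1 + C * ρ₁ z) * ρ₁ z := by fun_prop
  obtain ⟨c, hc, V, hV, haV, hcV⟩ := exists_le_leviForm_nhds hρ₂ (isCompact_singleton (x := a)) hC
  have hpos : ∀ᶠ z in 𝓝 a, 0 < 1 + C * ρ₁ z := by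
    have : Continuous fun z => 1 + C * ρ₁ z := by
      have := hρ₁c.continuous
      fun_prop
    exact this.continuousAt.eventually (lt_mem_nhds (by simp [ha0]))
  obtain ⟨r, hr, hball⟩ := Metric.eventually_nhds_iff_ball.1
    (hpos.and (heq.and ((hV.eventually_mem (haV rfl)).and (hU.eventually_mem haU))))
  refine ⟨r, hr, _, hρ₂, fun z hz => ?_, fun z hz w hw => ?_⟩
  · obtain ⟨h1, h2, -, h4⟩ := hball z hz
    rw [one_add_mul_mul_neg_iff h1, h2]
    exact hs₀ z h4
  · have := hcV z (hball z hz).2.2.1 w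
    have hw0 : 0 < ‖w‖ := norm_pos_iff.2 hw
    exact lt_of_lt_of_le (by positivity) this

theorem eventually_pos_of_fderiv_pos {E : Type*} [NormedAddCommGroup E] [NormedSpace ℝ E]
    {f : E → ℝ} {a v : E} (hf : DifferentiableAt ℝ f a) (h0 : f a = 0) (hv : 0 < fderiv ℝ f a v) :
    ∀ᶠ t in 𝓝[>] (0 : ℝ), 0 < f (a + t • v) := by
  have hl : HasDerivAt (fun t : ℝ => a + t • v) v 0 := by
    simpa using ((hasDerivAt_id (0 : ℝ)).smul_const v).const_add a
  have hf' : HasFDerivAt f (fderiv ℝ f a) (a + (0 : ℝ) • v) := by simpa using hf.hasFDerivAt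
  have h1 : HasDerivAt (fun t : ℝ => f (a + t • v)) (fderiv ℝ f a v) 0 :=
    hf'.comp_hasDerivAt (0 : ℝ) hl
  have h2 := (hasDerivAt_iff_tendsto_slope.1 h1).eventually (lt_mem_nhds hv)
  have h3 : ∀ᶠ t in 𝓝[>] (0 : ℝ), 0 < slope (fun t : ℝ => f (a + t • v)) 0 t :=
    h2.filter_mono (nhdsWithin_mono _ fun t (ht : 0 < t) => ht.ne')
  filter_upwards [h3, self_mem_nhdsWithin] with t ht htpos
  have htpos : 0 < t := htpos
  simp only [slope_def_field, zero_smul, add_zero, h0, sub_zero] at ht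
  exact (div_pos_iff_of_pos_right htpos).1 ht

/-- Two functions with the same negativity set near a common zero have compatible differentials. -/
theorem fderiv_nonneg_of_fderiv_pos {E : Type*} [NormedAddCommGroup E] [NormedSpace ℝ E]
    {f g : E → ℝ} {a v : E} (hf : DifferentiableAt ℝ f a) (hg : DifferentiableAt ℝ g a)
    (hfa : f a = 0) (hga : g a = 0) (hfg : ∀ᶠ z in 𝓝 a, g z < 0 → f z < 0)
    (hv : 0 < fderiv ℝ f a v) : 0 ≤ fderiv ℝ g a v := by
  by_contra! hneg
  have h1 := eventually_pos_of_fderiv_pos hf hfa hv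
  have hng : fderiv ℝ (fun z => -g z) a = -fderiv ℝ g a := fderiv_fun_neg
  have h2 := eventually_pos_of_fderiv_pos (f := fun z => -g z) (v := v) hg.neg (by simpa using hga)
    (by rw [hng]; simpa using hneg)
  have ht : Tendsto (fun t : ℝ => a + t • v) (𝓝[>] 0) (𝓝 a) := by
    have : Continuous fun t : ℝ => a + t • v := by fun_prop
    have := this.tendsto 0
    simp only [zero_smul, add_zero] at this
    exact this.mono_left nhdsWithin_le_nhds
  obtain ⟨t, ⟨h3, h4⟩, h5⟩ := ((h1.and h2).and (ht.eventually hfg)).exists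
  exact lt_asymm h3 (h5 (neg_pos.1 h4))

/-- A weighted sum of strictly plurisubharmonic local defining functions has positive Levi form on
its complex tangent space at boundary points. -/
theorem leviForm_sum_pos {n : ℕ} {D : Set (Cn n)} (hD : IsOpen D) {t : Finset (Cn n)}
    {r : Cn n → ℝ} {ρ : Cn n → Cn n → ℝ} (hρ : ∀ a ∈ t, ContDiff ℝ 2 (ρ a))
    (hs : ∀ a ∈ t, ∀ z ∈ ball a (2 * r a), z ∈ D ↔ ρ a z < 0)
    (hL : ∀ a ∈ t, ∀ z ∈ ball a (2 * r a), ∀ w, w ≠ 0 → 0 < leviForm (ρ a) z w)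
    {θ : Cn n → Cn n → ℝ} (hθ : ∀ a ∈ t, ContDiff ℝ 2 (θ a)) (hθ0 : ∀ a ∈ t, ∀ z, 0 ≤ θ a z)
    (hθt : ∀ a ∈ t, tsupport (θ a) ⊆ ball a (2 * r a))
    {z : Cn n} (hz : z ∈ frontier D) (hzt : ∃ a ∈ t, 0 < θ a z) {w : Cn n} (hw : w ≠ 0)
    (h1 : fderiv ℝ (fun z => ∑ a ∈ t, θ a z * ρ a z) z w = 0)
    (h2 : fderiv ℝ (fun z => ∑ a ∈ t, θ a z * ρ a z) z (Complex.I • w) = 0) :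
    0 < leviForm (fun z => ∑ a ∈ t, θ a z * ρ a z) z w := by
  have hmul : ∀ a ∈ t, ContDiff ℝ 2 fun z => θ a z * ρ a z := fun a ha => (hθ a ha).mul (hρ a ha)
  have hθd : ∀ a ∈ t, Differentiable ℝ (θ a) := fun a ha => (hθ a ha).differentiable (by norm_num)
  have hρd : ∀ a ∈ t, Differentiable ℝ (ρ a) := fun a ha => (hρ a ha).differentiable (by norm_num)
  have hzero : ∀ a ∈ t, z ∈ ball a (2 * r a) → ρ a z = 0 := fun a ha hza =>
    eq_zero_of_mem_frontier hD isOpen_ball (hρ a ha).continuous.continuousOn (hs a ha) hz hza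
  have hout : ∀ a ∈ t, z ∉ ball a (2 * r a) → (fun z => θ a z * ρ a z) =ᶠ[𝓝 z] fun _ => 0 := by
    intro a ha hza
    have := notMem_tsupport_iff_eventuallyEq.1 fun h => hza (hθt a ha h)
    filter_upwards [this] with y hy
    simp [hy]
  have hin : ∀ a ∈ t, 0 < θ a z → z ∈ ball a (2 * r a) := fun a ha h =>
    hθt a ha (subset_tsupport _ h.ne')
  have hsum : ∀ v, fderiv ℝ (fun z => ∑ a ∈ t, θ a z * ρ a z) z v =
      ∑ a ∈ t, θ a z * fderiv ℝ (ρ a) z v := by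
    intro v
    rw [fderiv_fun_sum fun a ha => (hmul a ha).differentiable (by norm_num) z,
      _root_.sum_apply]
    refine Finset.sum_congr rfl fun a ha => ?_
    by_cases hza : z ∈ ball a (2 * r a)
    · rw [fderiv_fun_mul (hθd a ha z) (hρd a ha z), hzero a ha hza]
      simp
    · rw [(hout a ha hza).fderiv_eq]
      have : θ a z = 0 := by
        by_contra hne
        exact hza (hin a ha (lt_of_le_of_ne (hθ0 a ha z) (Ne.symm hne)))
      simp [this]
  -- At a boundary point the differentials `dρ_b` never have opposite signs on `v`, so a weighted
  -- sum with one positive term cannot vanish. Applied to `v` and `-v`, this makes a vector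
  -- annihilated by the sum tangent for every active `ρ_a`.
  have hnotpos : ∀ v, fderiv ℝ (fun z => ∑ a ∈ t, θ a z * ρ a z) z v = 0 →
      ∀ a ∈ t, 0 < θ a z → ¬ 0 < fderiv ℝ (ρ a) z v := by
    intro v hv a ha hθa hpos
    rw [hsum] at hv
    refine (Finset.sum_pos' (fun b hb => ?_) ⟨a, ha, mul_pos hθa hpos⟩).ne' hv
    rcases (hθ0 b hb z).eq_or_lt with h | h
    · rw [← h, zero_mul]
    · refine mul_nonneg h.le ?_
      have hza := hin a ha hθa
      have hzb := hin b hb h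
      refine fderiv_nonneg_of_fderiv_pos (hρd a ha z) (hρd b hb z) (hzero a ha hza)
        (hzero b hb hzb) ?_ hpos
      filter_upwards [isOpen_ball.mem_nhds hza, isOpen_ball.mem_nhds hzb] with y hya hyb hy
      exact (hs a ha y hya).1 ((hs b hb y hyb).2 hy)
  have htan : ∀ v, fderiv ℝ (fun z => ∑ a ∈ t, θ a z * ρ a z) z v = 0 →
      ∀ a ∈ t, 0 < θ a z → fderiv ℝ (ρ a) z v = 0 := by
    intro v hv a ha hθa
    refine le_antisymm (not_lt.1 (hnotpos v hv a ha hθa)) ?_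
    have := hnotpos (-v) (by rw [map_neg, hv, neg_zero]) a ha hθa
    rw [map_neg, not_lt] at this
    linarith
  have hterm : ∀ a ∈ t, 0 ≤ leviForm (fun z => θ a z * ρ a z) z w ∧
      (0 < θ a z → 0 < leviForm (fun z => θ a z * ρ a z) z w) := by
    intro a ha
    by_cases hza : z ∈ ball a (2 * r a)
    · rw [leviForm_mul (hθ a ha) (hρ a ha) (hzero a ha hza)]
      rcases (hθ0 a ha z).eq_or_lt with h | h
      · have hmin : IsLocalMin (θ a) z := Eventually.of_forall fun y => by
          rw [← h]; exact hθ0 a ha y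
        rw [hmin.fderiv_eq_zero, ← h]
        simp
      · rw [htan w h1 a ha h, htan _ h2 a ha h]
        have := mul_pos h (hL a ha z hza w hw)
        simp only [mul_zero, add_zero, zero_div]
        exact ⟨this.le, fun _ => this⟩
    · rw [leviForm_congr (hout a ha hza)]
      refine ⟨by simp [leviForm], fun h => absurd (hin a ha h) hza⟩
  rw [leviForm_sum hmul]
  obtain ⟨a, ha, hpos⟩ := hzt
  exact Finset.sum_pos' (fun b hb => (hterm b hb).1) ⟨a, ha, (hterm a ha).2 hpos⟩

/-- A strictly plurisubharmonic defining function near a compact set of strongly pseudoconvex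
boundary points. -/
theorem exists_defining_function {n : ℕ} {D K : Set (Cn n)} (hD : IsOpen D) (hK : IsCompact K)
    (hKD : K ⊆ stronglyPseudoconvexPoints D) :
    ∃ ρ : Cn n → ℝ, ContDiff ℝ 2 ρ ∧ ∃ c > 0, ∃ V, IsOpen V ∧ K ⊆ V ∧
      (∀ z ∈ V, z ∈ D ↔ ρ z < 0) ∧ ∀ z ∈ V, ∀ w, c * ‖w‖ ^ 2 ≤ leviForm ρ z w := by
  have hloc : ∀ a ∈ K, ∃ r > 0, ∃ ρ : Cn n → ℝ, ContDiff ℝ 2 ρ ∧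
      (∀ z ∈ ball a (2 * r), z ∈ D ↔ ρ z < 0) ∧
      ∀ z ∈ ball a (2 * r), ∀ w, w ≠ 0 → 0 < leviForm ρ z w := by
    intro a ha
    obtain ⟨r, hr, ρ, h1, h2, h3⟩ := exists_local_defining_function hD (hKD ha)
    exact ⟨r / 2, half_pos hr, ρ, h1, by rwa [mul_div_cancel₀ r two_ne_zero],
      by rwa [mul_div_cancel₀ r two_ne_zero]⟩
  choose! r hr ρ hρ hs hL using hloc
  obtain ⟨t, htK, hcover⟩ := hK.elim_nhds_subcover (fun a => ball a (r a))
    fun a ha => ball_mem_nhds a (hr a ha)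
  have hbump : ∀ a, ∃ θ : Cn n → ℝ, a ∈ K → ContDiff ℝ 2 θ ∧ (∀ z, 0 ≤ θ z) ∧
      (∀ z, 0 < θ z ↔ z ∈ ball a (r a)) ∧ tsupport θ ⊆ ball a (2 * r a) := by
    intro a
    by_cases ha : a ∈ K
    · have hra := hr a ha
      let θ : ContDiffBump a := ⟨r a / 2, r a, half_pos hra, half_lt_self hra⟩
      refine ⟨θ, fun _ => ⟨θ.contDiff, fun z => θ.nonneg, fun z => ?_, ?_⟩⟩
      · have : z ∈ Function.support θ ↔ z ∈ ball a (r a) := by rw [θ.support_eq]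
        rw [← this, Function.mem_support]
        exact ⟨fun h => h.ne', fun h => lt_of_le_of_ne θ.nonneg h.symm⟩
      · rw [θ.tsupport_eq]
        exact closedBall_subset_ball (by change r a < _; linarith)
    · exact ⟨0, fun h => absurd h ha⟩
  choose θ hθ using hbump
  set σ : Cn n → ℝ := fun z => ∑ a ∈ t, θ a z * ρ a z with hσ
  have hσc : ContDiff ℝ 2 σ := ContDiff.sum fun a ha => (hθ a (htK a ha)).1.mul (hρ a (htK a ha))
  set V₀ : Set (Cn n) := ⋃ a ∈ t, ball a (r a) with hV₀
  have hV₀o : IsOpen V₀ := isOpen_biUnion fun a _ => isOpen_ball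
  have hsub : ∀ a ∈ t, ∀ z, 0 < θ a z → z ∈ ball a (2 * r a) := fun a ha z h =>
    (hθ a (htK a ha)).2.2.2 (subset_tsupport _ h.ne')
  have hσs : ∀ z ∈ V₀, z ∈ D ↔ σ z < 0 := by
    intro z hz
    obtain ⟨a, ha, hza⟩ := mem_iUnion₂.1 hz
    have hpos := ((hθ a (htK a ha)).2.2.1 z).2 hza
    constructor
    · intro hzD
      refine Finset.sum_neg' (fun b hb => ?_)
        ⟨a, ha, mul_neg_of_pos_of_neg hpos ((hs a (htK a ha) z (hsub a ha z hpos)).1 hzD)⟩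
      rcases ((hθ b (htK b hb)).2.1 z).eq_or_lt with h | h
      · rw [← h, zero_mul]
      · exact (mul_neg_of_pos_of_neg h ((hs b (htK b hb) z (hsub b hb z h)).1 hzD)).le
    · intro hneg
      by_contra hzD
      refine hneg.not_ge (Finset.sum_nonneg fun b hb => ?_)
      rcases ((hθ b (htK b hb)).2.1 z).eq_or_lt with h | h
      · rw [← h, zero_mul]
      · exact mul_nonneg h.le (not_lt.1 fun h' =>
          hzD ((hs b (htK b hb) z (hsub b hb z h)).2 h'))
  have hσ0 : ∀ a ∈ K, σ a = 0 := fun a ha => eq_zero_of_mem_frontier hD hV₀o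
    hσc.continuous.continuousOn hσs (hKD ha).1 (hcover ha)
  obtain ⟨C, -, hC⟩ := exists_leviForm_pos hσc hK hσ0 fun z hz w hw h1 h2 => by
    obtain ⟨a, ha, hza⟩ := mem_iUnion₂.1 (hcover hz)
    exact leviForm_sum_pos hD (fun a ha => hρ a (htK a ha)) (fun a ha => hs a (htK a ha))
      (fun a ha => hL a (htK a ha)) (fun a ha => (hθ a (htK a ha)).1)
      (fun a ha => (hθ a (htK a ha)).2.1) (fun a ha => (hθ a (htK a ha)).2.2.2)
      (hKD hz).1 ⟨a, ha, ((hθ a (htK a ha)).2.2.1 z).2 hza⟩ hw h1 h2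
  have hσ₂ : ContDiff ℝ 2 fun z => (1 + C * σ z) * σ z := by fun_prop
  obtain ⟨c, hc, V, hV, hKV, hcV⟩ := exists_le_leviForm_nhds hσ₂ hK hC
  have hP : IsOpen {z | 0 < 1 + C * σ z} := by
    have := hσc.continuous
    exact isOpen_lt continuous_const (by fun_prop)
  refine ⟨_, hσ₂, c, hc, V ∩ (V₀ ∩ {z | 0 < 1 + C * σ z}), hV.inter (hV₀o.inter hP), ?_, ?_, ?_⟩
  · exact fun z hz => ⟨hKV hz, hcover hz, by simp [hσ0 z hz]⟩
  · rintro z ⟨-, h1, h2⟩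
    rw [one_add_mul_mul_neg_iff h2]
    exact hσs z h1
  · exact fun z hz => hcV z hz.1

/-! ### The bumping construction -/

theorem exists_leviForm_le {n : ℕ} {f : Cn n → ℝ} (hf : ContDiff ℝ 2 f)
    (hfc : HasCompactSupport f) : ∃ M, 0 ≤ M ∧ ∀ z w, leviForm f z w ≤ M * ‖w‖ ^ 2 := by
  obtain ⟨M, hM⟩ := (hfc.isCompact.prod (isCompact_sphere (0 : Cn n) 1)).bddAbove_image
    (continuous_leviForm hf).continuousOn
  refine ⟨max M 0, le_max_right _ _, fun z w => ?_⟩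
  rcases eq_or_ne w 0 with rfl | hw
  · simp [leviForm]
  by_cases hz : z ∈ tsupport f
  · have hw0 : 0 < ‖w‖ := norm_pos_iff.2 hw
    have h1 : leviForm f z (‖w‖⁻¹ • w) ≤ M := hM ⟨(z, ‖w‖⁻¹ • w), ⟨hz, by
      rw [mem_sphere_zero_iff_norm, norm_smul, norm_inv, norm_norm, inv_mul_cancel₀ hw0.ne']⟩, rfl⟩
    rw [leviForm_smul, inv_pow, ← div_eq_inv_mul, div_le_iff₀ (by positivity)] at h1
    exact h1.trans (mul_le_mul_of_nonneg_right (le_max_left _ _) (sq_nonneg _))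
  · rw [leviForm_congr (notMem_tsupport_iff_eventuallyEq.1 hz)]
    have : 0 ≤ max M 0 * ‖w‖ ^ 2 := mul_nonneg (le_max_right _ _) (sq_nonneg _)
    simpa [leviForm] using this

/-- The bumping construction: `D` can be enlarged across a bounded relatively open set `A` of
boundary points with strongly pseudoconvex closure, within a given neighbourhood of the closure
of `A`, and so that the enlarged set is locally pseudoconvex there. -/
theorem exists_bump {n : ℕ} {D A W : Set (Cn n)} (hD : IsOpen D) (hA : IsRelOpenIn A (frontier D))
    (hAb : Bornology.IsBounded A) (hAs : closure A ⊆ stronglyPseudoconvexPoints D) (hW : IsOpen W)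
    (hAW : closure A ⊆ W) :
    ∃ N F V : Set (Cn n), IsOpen N ∧ IsClosed F ∧ IsOpen V ∧ N ⊆ F ∧ F ⊆ V ∧ V ⊆ W ∧
      N ∩ frontier D = A ∧
      ∀ b ∈ V, ∃ r > 0, ∃ G, IsPseudoconvex G ∧ (D ∪ N) ∩ ball b r = G ∩ ball b r := by
  have hK : IsCompact (closure A) := hAb.isCompact_closure
  obtain ⟨ρ, hρ, c, hc, V₀, hV₀, hKV₀, hs, hL⟩ := exists_defining_function hD hK hAs
  obtain ⟨O, hO, rfl⟩ := hA
  set A := frontier D ∩ O with hAdef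
  set V := V₀ ∩ W with hV
  have hVo : IsOpen V := hV₀.inter hW
  obtain ⟨δ, hδ, hδV⟩ := hK.exists_cthickening_subset_open hVo (subset_inter hKV₀ hAW)
  -- The nonvanishing set of `χ` is prescribed exactly: intersecting with `O` ensures that the bump
  -- meets the frontier in `A` and nowhere else.
  obtain ⟨χ, hχs, hχc, hχr⟩ := (hO.inter (isOpen_thickening (δ := δ)
    (E := closure A))).exists_contDiff_support_eq (n := 2)
  have hχ0 : ∀ z, 0 ≤ χ z := fun z => (hχr ⟨z, rfl⟩).1
  have hsupp : ∀ z, χ z ≠ 0 ↔ z ∈ O ∩ thickening δ (closure A) := fun z => by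
    rw [← hχs, Function.mem_support]
  have hχcs : HasCompactSupport χ := by
    refine HasCompactSupport.intro (K := cthickening δ (closure A)) hK.cthickening fun z hz => ?_
    by_contra hne
    exact hz (thickening_subset_cthickening _ _ ((hsupp z).1 hne).2)
  have hχc' : ContDiff ℝ 2 χ := hχc
  obtain ⟨M, hM0, hM⟩ := exists_leviForm_le hχc' hχcs
  -- Then `ε M ≤ c`, so subtracting `ε χ` keeps the Levi form nonnegative on `V`; the `+ 1` covers
  -- `M = 0`.
  set ε := c / (M + 1) with hε
  have hεpos : 0 < ε := by positivity
  have hεM : ε * M ≤ c := by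
    rw [hε, div_mul_eq_mul_div, div_le_iff₀ (by positivity)]
    nlinarith
  set σ : Cn n → ℝ := fun z => ρ z - ε * χ z with hσ
  have hσc : ContDiff ℝ 2 σ := by fun_prop
  have hσL : ∀ z ∈ V, ∀ w, 0 ≤ leviForm σ z w := by
    intro z hz w
    rw [hσ, leviForm_sub_const_mul hρ hχc']
    have h1 := hL z hz.1 w
    have h2 := mul_le_mul_of_nonneg_left (hM z w) hεpos.le
    have h3 := mul_le_mul_of_nonneg_right hεM (sq_nonneg ‖w‖)
    linarith
  set N := {z | χ z ≠ 0} ∩ {z | σ z < 0} with hN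
  have hNF : N ⊆ cthickening δ (closure A) := fun z hz =>
    thickening_subset_cthickening _ _ ((hsupp z).1 hz.1).2
  have hDN : ∀ z ∈ V, z ∈ D ∪ N ↔ σ z < 0 := by
    intro z hz
    constructor
    · rintro (h | h)
      · have h1 := (hs z hz.1).1 h
        have h2 := mul_nonneg hεpos.le (hχ0 z)
        simp only [hσ]
        linarith
      · exact h.2
    · intro h
      by_cases hχz : χ z = 0
      · left
        rw [hs z hz.1]
        simpa [hσ, hχz] using h
      · exact Or.inr ⟨hχz, h⟩
  refine ⟨N, cthickening δ (closure A), V, ?_, isClosed_cthickening, hVo, hNF, hδV,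
    inter_subset_right, ?_, ?_⟩
  · exact (isOpen_ne_fun hχc.continuous continuous_const).inter
      (isOpen_lt hσc.continuous continuous_const)
  · ext z
    constructor
    · rintro ⟨h1, h2⟩
      exact ⟨h2, ((hsupp z).1 h1.1).1⟩
    · intro hz
      have hzK : z ∈ closure A := subset_closure hz
      have hχz := (hsupp z).2 ⟨hz.2, self_subset_thickening hδ _ hzK⟩
      have hρz : ρ z = 0 := eq_zero_of_mem_frontier hD hV₀ hρ.continuous.continuousOn hs hz.1
        (hKV₀ hzK)
      refine ⟨⟨hχz, ?_⟩, hz.1⟩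
      have := mul_pos hεpos (lt_of_le_of_ne (hχ0 z) (Ne.symm hχz))
      simp only [hσ, mem_ofPred_eq, hρz]
      linarith
  · intro b hb
    obtain ⟨r, hr, hrV⟩ := Metric.isOpen_iff.1 hVo b hb
    refine ⟨r, hr, ball b r ∩ {z | σ z < 0}, ?_, ?_⟩
    · exact (continuityPrinciple_ball_inter_setOf_neg hr hσc
        fun z hz w => hσL z (hrV hz) w).isPseudoconvex
        (isOpen_ball.inter (isOpen_lt hσc.continuous continuous_const))
    · ext z
      constructor
      · rintro ⟨h1, h2⟩
        exact ⟨⟨h2, (hDN z (hrV h2)).1 h1⟩, h2⟩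
      · rintro ⟨⟨-, h1⟩, h2⟩
        exact ⟨(hDN z (hrV h2)).2 h1, h2⟩

/-! ### Separating and gluing the bumps -/

/-- Separated bounded sets have pairwise disjoint neighbourhoods of uniform size. -/
theorem exists_pairwise_disjoint_thickening {X : Type*} [PseudoMetricSpace X] [ProperSpace X]
    {J : Type*} {A : J → Set X} (hb : ∀ j, Bornology.IsBounded (A j))
    (hsep : ∀ j, closure (A j) ∩ closure (⋃ k ∈ {k : J | k ≠ j}, A k) = ∅) :
    ∃ δ : J → ℝ, (∀ j, 0 < δ j) ∧
      ∀ i j, i ≠ j → Disjoint (thickening (δ i) (A i)) (thickening (δ j) (A j)) := by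
  have h : ∀ j, ∃ d > 0, ∀ i, i ≠ j → ∀ x ∈ A j, ∀ y ∈ A i, d ≤ dist x y := by
    intro j
    obtain ⟨d, hd, hdisj⟩ := (disjoint_iff_inter_eq_empty.2 (hsep j)).exists_thickenings
      (hb j).isCompact_closure isClosed_closure
    refine ⟨d, hd, fun i hij x hx y hy => ?_⟩
    by_contra! hlt
    have hyT : y ∈ closure (⋃ k ∈ {k : J | k ≠ j}, A k) :=
      subset_closure (mem_biUnion (show i ∈ {k : J | k ≠ j} from hij) hy)
    exact disjoint_left.1 hdisj (self_subset_thickening hd _ (subset_closure hx))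
      (mem_thickening_iff.2 ⟨y, hyT, hlt⟩)
  choose d hd hdist using h
  -- The distance between two of the sets is at least both `d i` and `d j`, hence at least their
  -- mean.
  refine ⟨fun j => d j / 2, fun j => half_pos (hd j), fun i j hij => ?_⟩
  rw [disjoint_left]
  intro z hzi hzj
  obtain ⟨x, hx, hzx⟩ := mem_thickening_iff.1 hzi
  obtain ⟨y, hy, hzy⟩ := mem_thickening_iff.1 hzj
  have h1 := hdist i j hij.symm x hx y hy
  have h2 := hdist j i hij y hy x hx
  rw [dist_comm] at h2
  have h3 := dist_triangle_left x y z
  linarith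

/-- Adding arbitrarily many locally pseudoconvex bumps with disjoint supports preserves
pseudoconvexity. -/
theorem isPseudoconvex_union_iUnion {n : ℕ} {J : Type*} {D : Set (Cn n)} (hD : IsPseudoconvex D)
    {N F V : J → Set (Cn n)} (hN : ∀ j, IsOpen (N j)) (hF : ∀ j, IsClosed (F j))
    (hV : ∀ j, IsOpen (V j)) (hNF : ∀ j, N j ⊆ F j) (hFV : ∀ j, F j ⊆ V j)
    (hdisj : ∀ i j, i ≠ j → Disjoint (V i) (V j))
    (hloc : ∀ j, ∀ b ∈ V j, ∃ r > 0, ∃ G, IsPseudoconvex G ∧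
      (D ∪ N j) ∩ ball b r = G ∩ ball b r) :
    IsPseudoconvex (D ∪ ⋃ j, N j) := by
  have hopen : ∀ s : Finset J, IsOpen (D ∪ ⋃ j ∈ s, N j) := fun s =>
    hD.1.union (isOpen_biUnion fun j _ => hN j)
  -- Only finite unions are treated locally: infinitely many `F j` may accumulate, and their union
  -- need not be closed.
  have hfin : ∀ s : Finset J, ContinuityPrinciple (D ∪ ⋃ j ∈ s, N j) := by
    intro s
    refine continuityPrinciple_of_locally_isPseudoconvex (hopen s) fun b hb => ?_
    by_cases hbF : ∃ j ∈ s, b ∈ F j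
    · obtain ⟨j, hj, hbj⟩ := hbF
      obtain ⟨r, hr, G, hG, hDG⟩ := hloc j b (hFV j hbj)
      obtain ⟨r', hr', hrV⟩ := Metric.isOpen_iff.1 (hV j) b (hFV j hbj)
      refine ⟨min r r', lt_min hr hr', G, hG, ?_⟩
      ext z
      constructor
      · rintro ⟨h1, h2⟩
        have hz : z ∈ D ∪ N j := by
          refine h1.imp_right fun h => ?_
          obtain ⟨i, -, hi⟩ := mem_iUnion₂.1 h
          by_cases hij : i = j
          · rwa [← hij]
          · exact absurd (hrV (ball_subset_ball (min_le_right _ _) h2))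
              (disjoint_left.1 (hdisj i j hij) (hFV i (hNF i hi)))
        exact ⟨(hDG.subset ⟨hz, ball_subset_ball (min_le_left _ _) h2⟩).1, h2⟩
      · rintro ⟨h1, h2⟩
        refine ⟨?_, h2⟩
        exact (hDG.symm.subset ⟨h1, ball_subset_ball (min_le_left _ _) h2⟩).1.imp_right
          fun h => mem_biUnion hj h
    · push Not at hbF
      have hcl : IsClosed (⋃ j ∈ s, F j) := s.finite_toSet.isClosed_biUnion fun j _ => hF j
      obtain ⟨r, hr, hball⟩ := Metric.isOpen_iff.1 hcl.isOpen_compl b (by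
        simpa using hbF)
      refine ⟨r, hr, D, hD, ?_⟩
      ext z
      refine and_congr_left fun hz => ⟨fun h => h.resolve_right fun h' => ?_, Or.inl⟩
      obtain ⟨j, hj, hzj⟩ := mem_iUnion₂.1 h'
      exact hball hz (mem_biUnion hj (hNF j hzj))
  have hunion : D ∪ ⋃ j, N j = ⋃ s : Finset J, (D ∪ ⋃ j ∈ s, N j) := by
    rw [← union_iUnion, iUnion_eq_iUnion_finset]
  rw [hunion]
  refine (ContinuityPrinciple.iUnion_of_directed hopen ?_ hfin).isPseudoconvex (isOpen_iUnion hopen)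
  refine Monotone.directed_le fun s t hst => union_subset_union_right D ?_
  exact biUnion_subset_biUnion_left fun j hj => hst hj

end BoundaryCross

/-! ### Conclusion -/

theorem propositionC {n : ℕ} (D A : Set (BoundaryCross.Cn n))
    (hD : BoundaryCross.IsPseudoconvex D)
    (hA : BoundaryCross.IsRelOpenIn A (frontier D))
    {J : Type*} (Aj : J → Set (BoundaryCross.Cn n))
    (hAJ : A = ⋃ j, Aj j)
    (h_conn : ∀ j, IsPreconnected (Aj j))
    (h_open : ∀ j, BoundaryCross.IsRelOpenIn (Aj j) (frontier D))
    (h_bdd : ∀ j, Bornology.IsBounded (Aj j))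
    (h_sep : ∀ j, closure (Aj j) ∩ closure (⋃ k ∈ {k : J | k ≠ j}, Aj k) = ∅)
    (h_spc : (⋃ j, closure (Aj j)) ⊆ BoundaryCross.stronglyPseudoconvexPoints D) :
    BoundaryCross.HypothesisH A D := by
  obtain ⟨δ, hδ, hdisj⟩ := BoundaryCross.exists_pairwise_disjoint_thickening h_bdd h_sep
  -- The bound `δ j` keeps the bumps disjoint; the bound `1 / (k + 1)`, uniform in `j`, makes them
  -- shrink to the closure of `A`.
  have hη : ∀ (k : ℕ) (j : J), 0 < min (δ j) (1 / ((k : ℝ) + 1)) := fun k j =>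
    lt_min (hδ j) (by positivity)
  have hbump := fun (k : ℕ) (j : J) => BoundaryCross.exists_bump hD.1 (h_open j) (h_bdd j)
    ((Set.subset_iUnion _ j).trans h_spc) Metric.isOpen_thickening
    (Metric.closure_subset_thickening (hη k j) (Aj j))
  choose N F V hN hF hV hNF hFV hVW hNA hloc using hbump
  have hAfr : A ⊆ frontier D := by
    obtain ⟨O, -, rfl⟩ := hA
    exact Set.inter_subset_left
  have hcl : closure D = D ∪ frontier D := closure_eq_self_union_frontier D
  have hinter : ∀ k, (D ∪ ⋃ j, N k j) ∩ closure D = D ∪ A := by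
    intro k
    rw [hcl, ← Set.union_inter_distrib_left, Set.iUnion_inter, hAJ]
    simp only [hNA]
  refine ⟨fun k => D ∪ ⋃ j, N k j, fun k => ?_, hinter, ?_⟩
  · refine BoundaryCross.isPseudoconvex_union_iUnion hD (hN k) (hF k) (hV k) (hNF k) (hFV k)
      (fun i j hij => ?_) (hloc k)
    exact (hdisj i j hij).mono
      ((hVW k i).trans (Metric.thickening_mono (min_le_left _ _) _))
      ((hVW k j).trans (Metric.thickening_mono (min_le_left _ _) _))
  · refine Set.Subset.antisymm (fun z hz => ?_) (Set.subset_iInter fun k => ?_)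
    · rw [Set.mem_iInter] at hz
      by_cases hzD : z ∈ D
      · exact Or.inl hzD
      -- A point outside `D` lying in every enlarged set is a limit of points of `A`, hence in
      -- `closure D`, where each enlarged set is already just `D ∪ A`.
      have hzA : z ∈ closure A := by
        refine Metric.mem_closure_iff.2 fun ε hε => ?_
        obtain ⟨k, hk⟩ := exists_nat_one_div_lt hε
        obtain ⟨j, hj⟩ := Set.mem_iUnion.1 ((hz k).resolve_left hzD)
        obtain ⟨y, hy, hzy⟩ := Metric.mem_thickening_iff.1 (hVW k j (hFV k j (hNF k j hj)))
        refine ⟨y, hAJ ▸ Set.mem_iUnion_of_mem j hy, ?_⟩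
        exact (hzy.trans_le (min_le_right _ _)).trans hk
      have hzcl : z ∈ closure D :=
        closure_minimal (hAfr.trans frontier_subset_closure) isClosed_closure hzA
      exact (hinter 0).subset ⟨hz 0, hzcl⟩
    · rw [← hinter k]
      exact Set.inter_subset_left
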